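/- Let $\lambda>0$, $c>0$, $p,q\ge 0$ with $p+q=1$, and let $F$ be an arbitrary probability law on $(-\infty,0]$. Let $\xi(t)=\sum_{k\le\nu(t)}\xi_k$, $t\ge 0$, be a compound Poisson process: $\nu$ is a Poisson process of rate $\lambda$, independent of the i.i.d. jumps $\xi_k$, and each $\xi_k$ is, with probability $p$, exponential with rate $c$ and, with probability $q$, distributed according to $F$. Put $$\psi(\alpha)=\lambda p\Big(\frac{c}{c-i\alpha}-1\Big)+\lambda q\Big(\int_{(-\infty,0]}e^{i\alpha x}\,dF(x)-1\Big).$$ Let $s>0$, let $\theta_s$ be an exponential random variable with rate $s$ that is independent of the process, and let $\xi^{+}(t)=\sup_{0\le u\le t}\xi(u)$, $\xi^{-}(t)=\inf_{0\le u\le t}\xi(u)$, $$p_+(s)=\mathrm P\{\xi^+(\theta_s)=0\},\qquad q_+(s)=1-p_+(s),\qquad \rho_+(s)=c\,p_+(s),$$ and let $P_-(s,\cdot)$ be the law of $\xi^-(\theta_s)$. For $0<x<T$ let $\tau(x,T)=\inf\{t>0:\xi(t)\notin(x-T,x)\}$, $A_+(x)=\{\tau(x,T)<\infty,\ \xi(\tau(x,T))\ge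 x\}$ and $$Q^T(s,x)=\mathrm E\big[e^{-s\tau(x,T)};\,A_+(x)\big].$$ Then, if $p>0$, $\rho_+(s)$ is the unique positive root $r$ of Lundberg's equation $\psi(-ir)=s$; and, for all $0<x<T$, $$Q^T(s,x)=q_+(s)\,e^{-\rho_+(s)x}\int_{(x-T,0]}e^{\rho_+(s)y}\,dP_-(s,y)\left[e^{-\rho_+(s)T}\int_{(-\infty,-T]}e^{c(T+y)}\,dP_-(s,y)+\int_{(-T,0]}e^{\rho_+(s)y}\,dP_-(s,y)\right]^{-1}.$$ -/

import Mathlib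

open MeasureTheory ProbabilityTheory Set

noncomputable section

namespace AlmostSemicontinuous

/-- Law of a jump: with probability `p` exponential with rate `c`, with probability `q` of law `F`
(the law of the non-positive jumps). -/
def jumpLaw (p q c : ℝ) (F : Measure ℝ) : Measure ℝ :=
  ENNReal.ofReal p • expMeasure c + ENNReal.ofReal q • F

/-- The cumulant `ψ(α) = λp(c/(c - iα) - 1) + λq(∫ e^{iαx} dF(x) - 1)`. -/
def cumulant (lam p q c : ℝ) (F : Measure ℝ) (α : ℂ) : ℂ :=
  lam * p * (c / (c - Complex.I * α) - 1)
    + lam * q * ((∫ x : ℝ, Complex.exp (Complex.I * α * x) ∂F) - 1)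

variable {Ω : Type*}

/-- Time of the `(n+1)`-st jump, for waiting times `ζ 0, ζ 1, …`. -/
def arrival (ζ : ℕ → Ω → ℝ) (n : ℕ) (ω : Ω) : ℝ :=
  ∑ i ∈ Finset.range (n + 1), ζ i ω

/-- The counting process: the number of jump times in `[0, t]`. It is the Poisson process of rate
`λ` when the waiting times are independent and exponential with rate `λ`. -/
def count (ζ : ℕ → Ω → ℝ) (t : ℝ) (ω : Ω) : ℕ :=
  {n : ℕ | arrival ζ n ω ≤ t}.ncard

/-- The process `ξ(t)`, the sum of the first `ν(t)` jumps. -/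
def proc (ζ J : ℕ → Ω → ℝ) (t : ℝ) (ω : Ω) : ℝ :=
  ∑ k ∈ Finset.range (count ζ t ω), J k ω

/-- The running supremum `ξ⁺(t)` over `[0, t]`. -/
def runSup (ζ J : ℕ → Ω → ℝ) (t : ℝ) (ω : Ω) : ℝ :=
  sSup ((fun u => proc ζ J u ω) '' Icc 0 t)

/-- The running infimum `ξ⁻(t)` over `[0, t]`. -/
def runInf (ζ J : ℕ → Ω → ℝ) (t : ℝ) (ω : Ω) : ℝ :=
  sInf ((fun u => proc ζ J u ω) '' Icc 0 t)

/-- The times `t > 0` at which the process is outside `(x - T, x)`. -/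
def exitTimes (ζ J : ℕ → Ω → ℝ) (x T : ℝ) (ω : Ω) : Set ℝ :=
  {t : ℝ | 0 < t ∧ proc ζ J t ω ∉ Ioo (x - T) x}

/-- The first exit time `τ(x,T)`; meaningful only where `exitTimes` is non-empty (it is `+∞`
elsewhere in the mathematics). -/
def exitTime (ζ J : ℕ → Ω → ℝ) (x T : ℝ) (ω : Ω) : ℝ :=
  sInf (exitTimes ζ J x T ω)

/-- The event `A₊(x)`: the exit time is finite and the exit is through the upper boundary. -/
def exitAbove (ζ J : ℕ → Ω → ℝ) (x T : ℝ) : Set Ω :=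
  {ω | (exitTimes ζ J x T ω).Nonempty ∧ x ≤ proc ζ J (exitTime ζ J x T ω) ω}

variable [MeasurableSpace Ω]

/-- `Q^T(s,x) = E[e^{-s τ(x,T)}, A₊(x)]`. -/
def upperExitTransform (P : Measure Ω) (ζ J : ℕ → Ω → ℝ) (s x T : ℝ) : ℝ :=
  ∫ ω in exitAbove ζ J x T, Real.exp (-s * exitTime ζ J x T ω) ∂P

/-- `p₊(s) = P{ξ⁺(θ) = 0}`, for the random time `θ = θ_s`. -/
def pPlus (P : Measure Ω) (ζ J : ℕ → Ω → ℝ) (θ : Ω → ℝ) : ℝ :=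
  P.real {ω | runSup ζ J (θ ω) ω = 0}

/-- `q₊(s) = 1 - p₊(s)`. -/
def qPlus (P : Measure Ω) (ζ J : ℕ → Ω → ℝ) (θ : Ω → ℝ) : ℝ :=
  1 - pPlus P ζ J θ

/-- `ρ₊(s) = c p₊(s)`. -/
def rhoPlus (P : Measure Ω) (ζ J : ℕ → Ω → ℝ) (θ : Ω → ℝ) (c : ℝ) : ℝ :=
  c * pPlus P ζ J θ

/-- The law `P₋(s,·)` of `ξ⁻(θ)`, for the random time `θ = θ_s`. -/
def infLaw (P : Measure Ω) (ζ J : ℕ → Ω → ℝ) (θ : Ω → ℝ) : Measure ℝ :=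
  P.map (fun ω => runInf ζ J (θ ω) ω)

end AlmostSemicontinuous

end

namespace AlmostSemicontinuous

open scoped ENNReal

/-! Killing at rate `s` turns the process into a random walk discounted by `β = λ/(λ+s)` per step.
The number of jumps before `θ` is geometric and independent of the jumps, so the extrema at `θ` are
extrema of a walk stopped at an independent geometric time (`hasLaw_foldLaw`). The exit happens at a
jump time, so the exit transform is a `β`-discounted exit probability of the same walk
(`upperExitTransform_eq_upperExitSum`).

With `x` the distance to the upper boundary, both the tail of the maximum and the exit probability
solve `u(x) = β E u(x - J)` inside a domain, with prescribed values outside. As `β < 1`, this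
equation is a contraction and its bounded solution is unique (`eq_of_first_step`), so it suffices to
exhibit a solution.

By lack of memory, the overshoot of an upward jump is again exponential. Hence a boundary function
`h` may be replaced by the value `1` beyond the upper boundary as soon as its exponential mean there
is `1` (`first_step_piecewise`). Two functions are used.

If `r` is a positive Lundberg root, `e^{-rx}` solves the equation everywhere. Normalised by `1 -
r/c`, it is the tail of the maximum, and its value at `0` gives `q₊ = 1 - r/c`, that is `r = ρ₊`.
Since this applies to every root, uniqueness needs only existence of one.

For the two-sided exit the solution must also vanish for `x ≥ T`. Integrating `e^{ρ(w-x)}` against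
the law of the minimum over `w > x - T` achieves this, and the Lindley recursion for the minimum
shows that the equation persists for `x < T` (`tiltedTail_first_step`). Its exponential mean beyond
the boundary is `c/(c-ρ) = 1/q₊` times the bracket in the formula (`integral_tiltedTail_neg`,
`integral_boundary_eq`), which fixes the normalising constant. -/

/-! ### Splitting off the first term of an i.i.d. sequence. -/

theorem map_cons_prod_infinitePi (μ : Measure ℝ) [IsProbabilityMeasure μ] :
    (μ.prod (Measure.infinitePi fun _ : ℕ => μ)).map
      (fun z : ℝ × (ℕ → ℝ) => fun n : ℕ => (Nat.casesOn n z.1 z.2 : ℝ))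
      = Measure.infinitePi fun _ : ℕ => μ := by
  have hm : Measurable
      (fun z : ℝ × (ℕ → ℝ) => fun n : ℕ => (Nat.casesOn n z.1 z.2 : ℝ)) := by
    refine measurable_pi_lambda _ fun n => ?_
    cases n with
    | zero => exact measurable_fst
    | succ k => exact (measurable_pi_apply k).comp measurable_snd
  classical
  refine Measure.eq_infinitePi _ fun s t ht => ?_
  have hs : MeasurableSet (Set.pi (s : Set ℕ) t) :=
    MeasurableSet.pi s.countable_toSet fun i _ => ht i
  rw [Measure.map_apply hm hs]
  have hpre : (fun z : ℝ × (ℕ → ℝ) => fun n : ℕ => (Nat.casesOn n z.1 z.2 : ℝ)) ⁻¹'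
      (Set.pi (s : Set ℕ) t) = {a | 0 ∈ s → a ∈ t 0} ×ˢ
        Set.pi ((s.preimage Nat.succ Nat.succ_injective.injOn : Finset ℕ) : Set ℕ)
          (fun n => t (n + 1)) := by
    ext z
    simp only [mem_preimage, Set.mem_pi, mem_prod, mem_ofPred_eq, Finset.coe_preimage,
      Finset.mem_coe]
    constructor
    · exact fun h => ⟨fun h0 => h 0 h0, fun n hn => h (n + 1) hn⟩
    · rintro ⟨h0, h1⟩ n hn
      cases n with
      | zero => exact h0 hn
      | succ k => exact h1 k hn
  rw [hpre, Measure.prod_prod, Measure.infinitePi_pi _ fun i _ => ht _,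
    Finset.prod_preimage' Nat.succ s Nat.succ_injective.injOn (fun n => μ (t n))]
  -- The successor indices in `s` are all of `s` except possibly `0`, whose factor comes from the
  -- first coordinate.
  by_cases h0 : 0 ∈ s
  · have : s.filter (fun x => x ∈ range Nat.succ) = s.erase 0 := by
      ext n
      simp [Nat.range_succ, Nat.pos_iff_ne_zero, and_comm]
    rw [this, ← Finset.mul_prod_erase s _ h0]
    simp [h0]
  · have : s.filter (fun x => x ∈ range Nat.succ) = s := by
      refine Finset.filter_true_of_mem fun n hn => ?_
      simp only [Nat.range_succ, mem_ofPred_eq]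
      exact Nat.pos_of_ne_zero fun h => h0 (h ▸ hn)
    rw [this]
    simp [h0]

/-- The first term of an i.i.d. sequence is independent of the shifted sequence, which has the
law of the whole sequence. -/
theorem measurePreserving_uncons (μ : Measure ℝ) [IsProbabilityMeasure μ] :
    MeasurePreserving (fun j : ℕ → ℝ => (j 0, fun n => j (n + 1)))
      (Measure.infinitePi fun _ : ℕ => μ) (μ.prod (Measure.infinitePi fun _ : ℕ => μ)) := by
  have hm : Measurable
      (fun z : ℝ × (ℕ → ℝ) => fun n : ℕ => (Nat.casesOn n z.1 z.2 : ℝ)) := by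
    refine measurable_pi_lambda _ fun n => ?_
    cases n with
    | zero => exact measurable_fst
    | succ k => exact (measurable_pi_apply k).comp measurable_snd
  have hu : Measurable (fun j : ℕ → ℝ => (j 0, fun n => j (n + 1))) := by fun_prop
  refine ⟨hu, ?_⟩
  conv_lhs => rw [← map_cons_prod_infinitePi μ]
  rw [Measure.map_map hu hm]
  exact Measure.map_id

/-! ### Integrals against the exponential law. -/

section Exponential

variable {r : ℝ}

theorem expMeasure_eq_withDensity (r : ℝ) :
    expMeasure r = (volume.restrict (Ioi 0)).withDensity
      (fun x => ENNReal.ofReal (r * Real.exp (-(r * x)))) := by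
  have h : expMeasure r = volume.withDensity (exponentialPDF r) := rfl
  rw [h, ← withDensity_indicator measurableSet_Ioi]
  refine withDensity_congr_ae ?_
  have h0 : ∀ᵐ x : ℝ, x ≠ 0 := by simp [ae_iff]
  filter_upwards [h0] with x hx
  rcases lt_or_gt_of_ne hx with h | h
  · rw [exponentialPDF_of_neg h, indicator_of_notMem (by simpa using h.le)]
  · rw [exponentialPDF_of_nonneg h.le, indicator_of_mem (by simpa using h)]

theorem ae_expMeasure_pos (r : ℝ) : ∀ᵐ x ∂(expMeasure r), 0 < x := by
  rw [expMeasure_eq_withDensity]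
  exact (withDensity_absolutelyContinuous _ _).ae_le (ae_restrict_mem measurableSet_Ioi)

theorem integral_expMeasure (hr : 0 < r) (f : ℝ → ℝ) :
    ∫ x, f x ∂(expMeasure r) = ∫ x in Ioi 0, r * Real.exp (-(r * x)) * f x := by
  rw [expMeasure_eq_withDensity,
    integral_withDensity_eq_integral_toReal_smul (by fun_prop) (by simp)]
  refine integral_congr_ae (Filter.Eventually.of_forall fun x => ?_)
  simp only [smul_eq_mul]
  rw [ENNReal.toReal_ofReal (by positivity)]

theorem integrable_expMeasure_iff (hr : 0 < r) (f : ℝ → ℝ) :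
    Integrable f (expMeasure r) ↔
      IntegrableOn (fun x => r * Real.exp (-(r * x)) * f x) (Ioi 0) := by
  rw [expMeasure_eq_withDensity,
    integrable_withDensity_iff_integrable_smul' (by fun_prop) (by simp)]
  refine integrable_congr (Filter.Eventually.of_forall fun x => ?_)
  simp only [smul_eq_mul]
  rw [ENNReal.toReal_ofReal (by positivity)]

theorem integrable_exp_expMeasure (hr : 0 < r) {a : ℝ} (ha : a < r) :
    Integrable (fun x => Real.exp (a * x)) (expMeasure r) := by
  rw [integrable_expMeasure_iff hr]
  have := (exp_neg_integrableOn_Ioi 0 (sub_pos.2 ha)).const_mul r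
  refine this.congr (Filter.Eventually.of_forall fun x => ?_)
  simp only [mul_assoc, ← Real.exp_add]
  ring_nf

theorem setIntegral_Ioi_exp_expMeasure (hr : 0 < r) {a b : ℝ} (ha : a < r) (hb : 0 ≤ b) :
    ∫ x in Ioi b, Real.exp (a * x) ∂(expMeasure r) = r / (r - a) * Real.exp (-(r - a) * b) := by
  rw [← integral_indicator measurableSet_Ioi, integral_expMeasure hr]
  have h1 : ∀ x, r * Real.exp (-(r * x)) * (Ioi b).indicator (fun x => Real.exp (a * x)) x
      = (Ioi b).indicator (fun x => r * Real.exp (-(r - a) * x)) x := by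
    intro x
    by_cases hx : x ∈ Ioi b
    · simp only [indicator_of_mem hx, mul_assoc, ← Real.exp_add]
      ring_nf
    · simp [indicator_of_notMem hx]
  simp_rw [h1]
  rw [setIntegral_indicator measurableSet_Ioi, inter_eq_right.2 (Ioi_subset_Ioi hb),
    integral_const_mul, integral_exp_mul_Ioi (by linarith)]
  have : r - a ≠ 0 := by linarith
  have h2 : -(r - a) ≠ 0 := by linarith
  field_simp

theorem integral_exp_expMeasure (hr : 0 < r) {a : ℝ} (ha : a < r) :
    ∫ x, Real.exp (a * x) ∂(expMeasure r) = r / (r - a) := by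
  have h := setIntegral_Ioi_exp_expMeasure hr ha le_rfl
  rw [Measure.restrict_eq_self_of_ae_mem (s := Ioi 0) (ae_expMeasure_pos r)] at h
  simpa using h

theorem expMeasure_real_Ioi (hr : 0 < r) {b : ℝ} (hb : 0 ≤ b) :
    (expMeasure r).real (Ioi b) = Real.exp (-r * b) := by
  have h := setIntegral_Ioi_exp_expMeasure hr hr hb
  simpa [hr.ne'] using h

theorem expMeasure_Ici (hr : 0 < r) {b : ℝ} (hb : 0 ≤ b) :
    expMeasure r (Ici b) = ENNReal.ofReal (Real.exp (-r * b)) := by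
  have := isProbabilityMeasure_expMeasure hr
  have hna : NullSingletonClass (expMeasure r) := by
    rw [expMeasure_eq_withDensity]; infer_instance
  rw [measure_congr Ioi_ae_eq_Ici.symm, ← expMeasure_real_Ioi hr hb, ofReal_measureReal]

end Exponential

/-! ### From continuous time to partial sums along one path. -/

section Path

variable {Ω : Type*} {ζ J : ℕ → Ω → ℝ} {ω : Ω}

theorem arrival_strictMono (hpos : ∀ i, 0 < ζ i ω) : StrictMono fun n => arrival ζ n ω := by
  refine strictMono_nat_of_lt_succ fun n => ?_
  simp only [arrival]
  rw [Finset.sum_range_succ _ (n + 1)]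
  linarith [hpos (n + 1)]

theorem arrival_pos (hpos : ∀ i, 0 < ζ i ω) (n : ℕ) : 0 < arrival ζ n ω :=
  Finset.sum_pos (fun i _ => hpos i) (by simp)

theorem count_eq_of_mem (hpos : ∀ i, 0 < ζ i ω) {n : ℕ} {t : ℝ}
    (h : ∀ k < n, arrival ζ k ω ≤ t) (h' : t < arrival ζ n ω) : count ζ t ω = n := by
  have : {k : ℕ | arrival ζ k ω ≤ t} = Iio n := by
    ext k
    simp only [mem_ofPred_eq, mem_Iio]
    refine ⟨fun hk => ?_, h k⟩
    exact (arrival_strictMono hpos).lt_iff_lt.1 (hk.trans_lt h')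
  rw [count, this, ← Finset.coe_Iio, ncard_coe_finset, Nat.card_Iio]

theorem exists_count_cell (htop : ∀ b, ∃ n, b < arrival ζ n ω) (t : ℝ) :
    ∃ n, (∀ k < n, arrival ζ k ω ≤ t) ∧ t < arrival ζ n ω := by
  classical
  exact ⟨Nat.find (htop t), fun k hk => not_lt.1 (Nat.find_min (htop t) hk),
    Nat.find_spec (htop t)⟩

theorem proc_eq_of_mem (hpos : ∀ i, 0 < ζ i ω) {n : ℕ} {t : ℝ}
    (h : ∀ k < n, arrival ζ k ω ≤ t) (h' : t < arrival ζ n ω) :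
    proc ζ J t ω = ∑ k ∈ Finset.range n, J k ω := by
  rw [proc, count_eq_of_mem hpos h h']

theorem proc_arrival (hpos : ∀ i, 0 < ζ i ω) (n : ℕ) :
    proc ζ J (arrival ζ n ω) ω = ∑ k ∈ Finset.range (n + 1), J k ω :=
  proc_eq_of_mem hpos
    (fun _ hk => (arrival_strictMono hpos).monotone (Nat.lt_succ_iff.1 hk))
    (arrival_strictMono hpos (Nat.lt_succ_self n))

/-- The values of the process on `[0, t]` are the partial sums up to the number of jumps. -/
theorem image_proc_Icc (hpos : ∀ i, 0 < ζ i ω) {n : ℕ} {t : ℝ} (ht : 0 ≤ t)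
    (h : ∀ k < n, arrival ζ k ω ≤ t) (h' : t < arrival ζ n ω) :
    (fun u => proc ζ J u ω) '' Icc 0 t
      = (fun m => ∑ k ∈ Finset.range m, J k ω) '' Iic n := by
  have hmono := arrival_strictMono hpos
  ext y
  constructor
  · rintro ⟨u, hu, rfl⟩
    obtain ⟨m, hm, hm'⟩ : ∃ m, (∀ k < m, arrival ζ k ω ≤ u) ∧ u < arrival ζ m ω := by
      classical
      have hex : ∃ m, u < arrival ζ m ω := ⟨n, hu.2.trans_lt h'⟩
      exact ⟨Nat.find hex, fun k hk => not_lt.1 (Nat.find_min hex hk), Nat.find_spec hex⟩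
    refine ⟨m, ?_, (proc_eq_of_mem hpos hm hm').symm⟩
    by_contra hmn
    have h1 := hm n (not_le.1 hmn)
    linarith [hu.2]
  · rintro ⟨m, hm, rfl⟩
    cases m with
    | zero =>
      exact ⟨0, ⟨le_rfl, ht⟩, proc_eq_of_mem hpos (by simp) (arrival_pos hpos 0)⟩
    | succ m =>
      exact ⟨arrival ζ m ω, ⟨(arrival_pos hpos m).le, h m hm⟩, proc_arrival hpos m⟩

/-- The path is constant between jumps, so it can leave the interval only at a jump time, and the
infimum is attained. -/
theorem isLeast_exitTimes (hpos : ∀ i, 0 < ζ i ω) {x T : ℝ} {n : ℕ}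
    (hin : ∀ m ≤ n, ∑ k ∈ Finset.range m, J k ω ∈ Ioo (x - T) x)
    (hout : ∑ k ∈ Finset.range (n + 1), J k ω ∉ Ioo (x - T) x) :
    IsLeast (exitTimes ζ J x T ω) (arrival ζ n ω) := by
  refine ⟨⟨arrival_pos hpos n, by rwa [proc_arrival hpos]⟩, fun t ht => ?_⟩
  by_contra hlt
  rw [not_le] at hlt
  classical
  have hex : ∃ m, t < arrival ζ m ω := ⟨n, hlt⟩
  refine ht.2 ?_
  rw [proc_eq_of_mem hpos (fun k hk => not_lt.1 (Nat.find_min hex hk)) (Nat.find_spec hex)]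
  exact hin _ (Nat.find_min' hex hlt)

/-- The jump sequences for which the walk leaves `(x - T, x)` at the jump of index `n`, through
the upper boundary. -/
def upperExit (T : ℝ) (n : ℕ) (x : ℝ) : Set (ℕ → ℝ) :=
  {j | (∀ m ≤ n, ∑ k ∈ Finset.range m, j k ∈ Ioo (x - T) x) ∧
    x ≤ ∑ k ∈ Finset.range (n + 1), j k}

theorem exitTime_eq_of_mem_upperExit (hpos : ∀ i, 0 < ζ i ω) {x T : ℝ} {n : ℕ}
    (h : (fun k => J k ω) ∈ upperExit T n x) : exitTime ζ J x T ω = arrival ζ n ω :=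
  (isLeast_exitTimes hpos h.1 fun h' => absurd h'.2 (not_lt.2 h.2)).csInf_eq

/-- The role of `htop` is to place every time between two consecutive jumps; otherwise the count
could be the `ncard` of an infinite set, which is `0` by convention. -/
theorem mem_exitAbove_iff (hpos : ∀ i, 0 < ζ i ω) (htop : ∀ b, ∃ n, b < arrival ζ n ω)
    {x T : ℝ} (hx : 0 < x) (hxT : x < T) :
    ω ∈ exitAbove ζ J x T ↔ ∃ n, (fun k => J k ω) ∈ upperExit T n x := by
  classical
  constructor
  · rintro ⟨⟨t, ht⟩, h⟩
    have hex : ∃ m, ∑ k ∈ Finset.range m, J k ω ∉ Ioo (x - T) x := by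
      obtain ⟨m, hm, hm'⟩ := exists_count_cell htop t
      refine ⟨m, ?_⟩
      rw [← proc_eq_of_mem hpos hm hm']
      exact ht.2
    obtain ⟨n, hn⟩ : ∃ n, Nat.find hex = n + 1 := by
      refine Nat.exists_eq_succ_of_ne_zero fun h0 => ?_
      have := Nat.find_spec hex
      rw [h0] at this
      refine this ?_
      simp only [Finset.range_zero, Finset.sum_empty, mem_Ioo]
      constructor <;> linarith
    have hin : ∀ m ≤ n, ∑ k ∈ Finset.range m, J k ω ∈ Ioo (x - T) x := fun m hm =>
      not_not.1 (Nat.find_min hex (by omega))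
    have hout : ∑ k ∈ Finset.range (n + 1), J k ω ∉ Ioo (x - T) x := hn ▸ Nat.find_spec hex
    refine ⟨n, hin, ?_⟩
    rw [exitTime, (isLeast_exitTimes hpos hin hout).csInf_eq, proc_arrival hpos] at h
    exact h
  · rintro ⟨n, hn⟩
    refine ⟨⟨_, (isLeast_exitTimes hpos hn.1 fun h' => absurd h'.2 (not_lt.2 hn.2)).1⟩, ?_⟩
    rw [exitTime_eq_of_mem_upperExit hpos hn, proc_arrival hpos]
    exact hn.2

end Path

/-! ### Upper exit events of the walk. -/

/-- Joint measurability in the level and the jumps is needed because the first-step equation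
integrates over the shifted level `x - j`. -/
theorem measurableSet_upperExit (T : ℝ) (n : ℕ) :
    MeasurableSet {z : ℝ × (ℕ → ℝ) | z.2 ∈ upperExit T n z.1} := by
  have : {z : ℝ × (ℕ → ℝ) | z.2 ∈ upperExit T n z.1}
      = (⋂ m ∈ Finset.range (n + 1),
          ({z : ℝ × (ℕ → ℝ) | z.1 - T < ∑ k ∈ Finset.range m, z.2 k}
            ∩ {z : ℝ × (ℕ → ℝ) | ∑ k ∈ Finset.range m, z.2 k < z.1}))
        ∩ {z : ℝ × (ℕ → ℝ) | z.1 ≤ ∑ k ∈ Finset.range (n + 1), z.2 k} := by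
    ext z
    simp [upperExit]
  rw [this]
  have hS : ∀ m, Measurable fun z : ℝ × (ℕ → ℝ) => ∑ k ∈ Finset.range m, z.2 k := by
    intro m; fun_prop
  refine MeasurableSet.inter (Finset.measurableSet_biInter _ fun m _ => ?_)
    (measurableSet_le measurable_fst (hS _))
  exact (measurableSet_lt (by fun_prop) (hS m)).inter (measurableSet_lt (hS m) measurable_fst)

theorem measurableSet_upperExit_section (T : ℝ) (n : ℕ) (x : ℝ) :
    MeasurableSet (upperExit T n x) :=
  (measurable_prodMk_left (x := x)) (measurableSet_upperExit T n)

theorem pairwise_disjoint_upperExit (T x : ℝ) :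
    Pairwise (Function.onFun Disjoint fun n => upperExit T n x) := by
  refine (pairwise_disjoint_on _).2 fun m n hmn => ?_
  refine disjoint_left.2 fun j hm hn => ?_
  exact absurd (hn.1 (m + 1) hmn).2 (not_lt.2 hm.2)

theorem upperExit_eq_empty {T x : ℝ} (h : ¬ (0 < x ∧ x < T)) (n : ℕ) : upperExit T n x = ∅ := by
  refine eq_empty_of_forall_notMem fun j hj => h ?_
  have := hj.1 0 (Nat.zero_le n)
  simp only [Finset.range_zero, Finset.sum_empty, mem_Ioo] at this
  exact ⟨this.2, by linarith [this.1]⟩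

theorem mem_upperExit_zero {T x : ℝ} (h : 0 < x ∧ x < T) (j : ℕ → ℝ) :
    j ∈ upperExit T 0 x ↔ x ≤ j 0 := by
  simp [upperExit, h.1, h.2]

/-- After a first jump the remaining walk sees an interval of the same length `T`, translated by
that jump; only the parameter `x` changes. -/
theorem mem_upperExit_succ {T x : ℝ} (h : 0 < x ∧ x < T) (n : ℕ) (j : ℕ → ℝ) :
    j ∈ upperExit T (n + 1) x ↔ (fun k => j (k + 1)) ∈ upperExit T n (x - j 0) := by
  simp only [upperExit, mem_ofPred_eq]
  constructor
  · rintro ⟨h1, h2⟩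
    refine ⟨fun m hm => ?_, ?_⟩
    · have := h1 (m + 1) (by omega)
      rw [Finset.sum_range_succ', mem_Ioo] at this
      constructor <;> linarith [this.1, this.2]
    · rw [Finset.sum_range_succ'] at h2
      linarith
  · rintro ⟨h1, h2⟩
    refine ⟨fun m hm => ?_, ?_⟩
    · cases m with
      | zero =>
        simp only [Finset.range_zero, Finset.sum_empty, mem_Ioo]
        constructor <;> linarith [h.1, h.2]
      | succ m =>
        have := h1 m (by omega)
        rw [mem_Ioo] at this
        rw [Finset.sum_range_succ']
        constructor <;> linarith [this.1, this.2]
    · rw [Finset.sum_range_succ']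
      linarith

/-! ### Running extrema by the Lindley recursion. -/

/-- The Lindley-type recursion `R₀ = 0`, `Rₙ₊₁(j) = φ(j₀ + Rₙ(j₁, j₂, …))`. It gives the running
minimum of the walk for `φ = min 0` and the running maximum for `φ = max 0`. -/
def runFold (φ : ℝ → ℝ) : ℕ → (ℕ → ℝ) → ℝ
  | 0, _ => 0
  | n + 1, j => φ (j 0 + runFold φ n fun k => j (k + 1))

theorem measurable_runFold {φ : ℝ → ℝ} (hφ : Measurable φ) (n : ℕ) :
    Measurable (runFold φ n) := by
  induction n with
  | zero => exact measurable_const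
  | succ n ih =>
    exact hφ.comp ((measurable_pi_apply 0).add (ih.comp (by fun_prop)))

theorem image_walk_Iic_succ (n : ℕ) (j : ℕ → ℝ) :
    (fun m => ∑ k ∈ Finset.range m, j k) '' Iic (n + 1)
      = insert 0 ((fun y => j 0 + y) ''
          ((fun m => ∑ k ∈ Finset.range m, j (k + 1)) '' Iic n)) := by
  ext y
  simp only [mem_image, mem_Iic, mem_insert_iff, exists_exists_and_eq_and]
  constructor
  · rintro ⟨m, hm, rfl⟩
    cases m with
    | zero => simp
    | succ m => exact Or.inr ⟨m, by omega, by rw [Finset.sum_range_succ', add_comm]⟩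
  · rintro (rfl | ⟨m, hm, rfl⟩)
    · exact ⟨0, by omega, by simp⟩
    · exact ⟨m + 1, by omega, by rw [Finset.sum_range_succ', add_comm]⟩

theorem isLeast_runFold_min (n : ℕ) (j : ℕ → ℝ) :
    IsLeast ((fun m => ∑ k ∈ Finset.range m, j k) '' Iic n) (runFold (min 0) n j) := by
  induction n generalizing j with
  | zero => simp [runFold, Iic, isLeast_singleton]
  | succ n ih =>
    rw [image_walk_Iic_succ]
    refine IsLeast.insert 0 ?_
    exact (add_right_mono (a := j 0)).map_isLeast (ih _)

theorem isGreatest_runFold_max (n : ℕ) (j : ℕ → ℝ) :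
    IsGreatest ((fun m => ∑ k ∈ Finset.range m, j k) '' Iic n) (runFold (max 0) n j) := by
  induction n generalizing j with
  | zero => simp [runFold, Iic, isGreatest_singleton]
  | succ n ih =>
    rw [image_walk_Iic_succ]
    refine IsGreatest.insert 0 ?_
    exact (add_right_mono (a := j 0)).map_isGreatest (ih _)

section Path

variable {Ω : Type*} {ζ J : ℕ → Ω → ℝ} {ω : Ω}

theorem runInf_eq_runFold (hpos : ∀ i, 0 < ζ i ω) {n : ℕ} {t : ℝ} (ht : 0 ≤ t)
    (h : ∀ k < n, arrival ζ k ω ≤ t) (h' : t < arrival ζ n ω) :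
    runInf ζ J t ω = runFold (min 0) n fun k => J k ω := by
  rw [runInf, image_proc_Icc hpos ht h h']
  exact (isLeast_runFold_min n fun k => J k ω).csInf_eq

theorem runSup_eq_runFold (hpos : ∀ i, 0 < ζ i ω) {n : ℕ} {t : ℝ} (ht : 0 ≤ t)
    (h : ∀ k < n, arrival ζ k ω ≤ t) (h' : t < arrival ζ n ω) :
    runSup ζ J t ω = runFold (max 0) n fun k => J k ω := by
  rw [runSup, image_proc_Icc hpos ht h h']
  exact (isGreatest_runFold_max n fun k => J k ω).csSup_eq

end Path

/-! ### Laplace transforms and divergence of the jump times. -/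

theorem lintegral_exp_expMeasure {r : ℝ} (hr : 0 < r) {s : ℝ} (hs : 0 < s) :
    ∫⁻ x, ENNReal.ofReal (Real.exp (-s * x)) ∂(expMeasure r) = ENNReal.ofReal (r / (r + s)) := by
  rw [← ofReal_integral_eq_lintegral_ofReal (integrable_exp_expMeasure hr (by linarith))
    (Filter.Eventually.of_forall fun x => (Real.exp_pos _).le),
    integral_exp_expMeasure hr (by linarith), sub_neg_eq_add]

theorem lintegral_exp_partialSum {lam : ℝ} (hlam : 0 < lam) {s : ℝ} (hs : 0 < s) (n : ℕ) :
    ∫⁻ z, ENNReal.ofReal (Real.exp (-s * ∑ i ∈ Finset.range n, z i))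
      ∂(Measure.infinitePi fun _ : ℕ => expMeasure lam)
      = ENNReal.ofReal (lam / (lam + s)) ^ n := by
  have := isProbabilityMeasure_expMeasure hlam
  induction n with
  | zero => simp
  | succ n ih =>
    have h : ∀ z : ℕ → ℝ, ENNReal.ofReal (Real.exp (-s * ∑ i ∈ Finset.range (n + 1), z i))
        = (fun w : ℝ × (ℕ → ℝ) => ENNReal.ofReal (Real.exp (-s * w.1)) *
          ENNReal.ofReal (Real.exp (-s * ∑ i ∈ Finset.range n, w.2 i)))
            (z 0, fun k => z (k + 1)) := by
      intro z
      simp only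
      rw [← ENNReal.ofReal_mul (Real.exp_pos _).le, ← Real.exp_add, Finset.sum_range_succ']
      ring_nf
    rw [lintegral_congr h,
      (measurePreserving_uncons (expMeasure lam)).lintegral_comp
        (f := fun w : ℝ × (ℕ → ℝ) => ENNReal.ofReal (Real.exp (-s * w.1)) *
          ENNReal.ofReal (Real.exp (-s * ∑ i ∈ Finset.range n, w.2 i))) (by fun_prop),
      lintegral_prod_mul (f := fun x : ℝ => ENNReal.ofReal (Real.exp (-s * x)))
        (g := fun z : ℕ → ℝ => ENNReal.ofReal (Real.exp (-s * ∑ i ∈ Finset.range n, z i)))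
        (by fun_prop) (by fun_prop), ih,
      lintegral_exp_expMeasure hlam hs, pow_succ']

theorem ae_waiting_pos {lam : ℝ} (hlam : 0 < lam) :
    ∀ᵐ z ∂(Measure.infinitePi fun _ : ℕ => expMeasure lam), ∀ i, 0 < z i := by
  have := isProbabilityMeasure_expMeasure hlam
  refine ae_all_iff.2 fun i => ?_
  exact (measurePreserving_eval_infinitePi
    (fun _ : ℕ => expMeasure lam) i).quasiMeasurePreserving.ae (ae_expMeasure_pos lam)

/-- The expectation of `∑ e^{-Sₙ}` is a convergent geometric series, so almost surely `e^{-Sₙ} → 0`.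
-/
theorem ae_partialSum_unbounded {lam : ℝ} (hlam : 0 < lam) :
    ∀ᵐ z ∂(Measure.infinitePi fun _ : ℕ => expMeasure lam),
      ∀ b : ℝ, ∃ n, b < ∑ i ∈ Finset.range (n + 1), z i := by
  have := isProbabilityMeasure_expMeasure hlam
  have hfin : ∫⁻ z, ∑' n, ENNReal.ofReal (Real.exp (-1 * ∑ i ∈ Finset.range n, z i))
      ∂(Measure.infinitePi fun _ : ℕ => expMeasure lam) ≠ ∞ := by
    rw [lintegral_tsum fun n => by fun_prop]
    simp_rw [lintegral_exp_partialSum hlam one_pos]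
    rw [ENNReal.tsum_geometric]
    have : lam / (lam + 1) < 1 := (div_lt_one (by linarith)).2 (by linarith)
    simpa [tsub_eq_zero_iff_le] using this
  filter_upwards [ae_lt_top' (by fun_prop) hfin] with z hz b
  have h0 := ENNReal.tendsto_atTop_zero_of_tsum_ne_top hz.ne
  have h1 := (h0.comp (Filter.tendsto_add_atTop_nat 1)).eventually
    (gt_mem_nhds (ENNReal.ofReal_pos.2 (Real.exp_pos (-b))))
  obtain ⟨n, hn⟩ := h1.exists
  refine ⟨n, ?_⟩
  simp only [Function.comp] at hn
  rw [ENNReal.ofReal_lt_ofReal_iff (Real.exp_pos _), Real.exp_lt_exp] at hn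
  linarith

/-! ### The number of jumps before the exponential time is geometric. -/

section Cells

variable {lam s : ℝ} {μ : Measure ℝ} [IsProbabilityMeasure μ]

/-- The set where exactly `n` jump times are at most `θ`, for `(θ, ζ, J)` in the canonical
space. -/
def countCell (n : ℕ) : Set (ℝ × ((ℕ → ℝ) × (ℕ → ℝ))) :=
  {y | ∑ i ∈ Finset.range n, y.2.1 i ≤ y.1 ∧ y.1 < ∑ i ∈ Finset.range (n + 1), y.2.1 i}

theorem measurableSet_countCell (n : ℕ) : MeasurableSet (countCell n) := by
  refine MeasurableSet.inter
    (s₁ := {y : ℝ × ((ℕ → ℝ) × (ℕ → ℝ)) | ∑ i ∈ Finset.range n, y.2.1 i ≤ y.1})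
    (s₂ := {y : ℝ × ((ℕ → ℝ) × (ℕ → ℝ)) | y.1 < ∑ i ∈ Finset.range (n + 1), y.2.1 i})
    (measurableSet_le ?_ ?_) (measurableSet_lt ?_ ?_) <;> fun_prop

theorem measurableSet_partialSum_le (n : ℕ) {B : Set (ℕ → ℝ)} (hB : MeasurableSet B) :
    MeasurableSet {y : ℝ × ((ℕ → ℝ) × (ℕ → ℝ)) |
      ∑ i ∈ Finset.range n, y.2.1 i ≤ y.1 ∧ y.2.2 ∈ B} := by
  refine MeasurableSet.inter
    (s₁ := {y : ℝ × ((ℕ → ℝ) × (ℕ → ℝ)) | ∑ i ∈ Finset.range n, y.2.1 i ≤ y.1})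
    (measurableSet_le ?_ ?_) ((measurable_snd.comp measurable_snd) hB) <;> fun_prop

/-- Integrating out `θ` first gives `P{θ ≥ Sₙ} = e^{-s Sₙ}` for fixed waiting times; the Laplace
transform of `Sₙ` then yields `βⁿ`, and the jumps factor out. -/
theorem measure_partialSum_le (hlam : 0 < lam) (hs : 0 < s) (n : ℕ) {B : Set (ℕ → ℝ)}
    (hB : MeasurableSet B) :
    (expMeasure s).prod ((Measure.infinitePi fun _ : ℕ => expMeasure lam).prod
      (Measure.infinitePi fun _ : ℕ => μ))
      {y | ∑ i ∈ Finset.range n, y.2.1 i ≤ y.1 ∧ y.2.2 ∈ B}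
      = ENNReal.ofReal (lam / (lam + s)) ^ n * (Measure.infinitePi fun _ : ℕ => μ) B := by
  have := isProbabilityMeasure_expMeasure hlam
  have := isProbabilityMeasure_expMeasure hs
  rw [Measure.prod_apply_symm (measurableSet_partialSum_le n hB)]
  have hae : ∀ᵐ z ∂((Measure.infinitePi fun _ : ℕ => expMeasure lam).prod
      (Measure.infinitePi fun _ : ℕ => μ)), ∀ i, 0 < z.1 i :=
    Measure.quasiMeasurePreserving_fst.ae (ae_waiting_pos hlam)
  have hcongr : ∀ᵐ z ∂((Measure.infinitePi fun _ : ℕ => expMeasure lam).prod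
      (Measure.infinitePi fun _ : ℕ => μ)),
      expMeasure s ((fun t => (t, z)) ⁻¹' {y : ℝ × ((ℕ → ℝ) × (ℕ → ℝ)) |
        ∑ i ∈ Finset.range n, y.2.1 i ≤ y.1 ∧ y.2.2 ∈ B})
      = ENNReal.ofReal (Real.exp (-s * ∑ i ∈ Finset.range n, z.1 i)) *
        B.indicator (fun _ => (1 : ℝ≥0∞)) z.2 := by
    filter_upwards [hae] with z hz
    by_cases hzB : z.2 ∈ B
    · rw [indicator_of_mem hzB, mul_one,
        ← expMeasure_Ici hs (Finset.sum_nonneg fun i _ => (hz i).le)]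
      congr 1
      ext t
      simp [hzB]
    · rw [indicator_of_notMem hzB, mul_zero]
      convert measure_empty (μ := expMeasure s)
      ext t
      simp [hzB]
  rw [lintegral_congr_ae hcongr, lintegral_prod_mul
    (f := fun z : ℕ → ℝ => ENNReal.ofReal (Real.exp (-s * ∑ i ∈ Finset.range n, z i)))
    (g := B.indicator (fun _ => (1 : ℝ≥0∞))) (by fun_prop)
    (measurable_const.indicator hB).aemeasurable,
    lintegral_exp_partialSum hlam hs, lintegral_indicator hB, setLIntegral_one]

/-- The cell is the difference of two consecutive events of the previous kind, so its weight is `βⁿ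
- βⁿ⁺¹`. -/
theorem measure_countCell_inter (hlam : 0 < lam) (hs : 0 < s) (n : ℕ) {B : Set (ℕ → ℝ)}
    (hB : MeasurableSet B) :
    (expMeasure s).prod ((Measure.infinitePi fun _ : ℕ => expMeasure lam).prod
      (Measure.infinitePi fun _ : ℕ => μ)) (countCell n ∩ {y | y.2.2 ∈ B})
      = ENNReal.ofReal ((1 - lam / (lam + s)) * (lam / (lam + s)) ^ n) *
        (Measure.infinitePi fun _ : ℕ => μ) B := by
  have := isProbabilityMeasure_expMeasure hlam
  have := isProbabilityMeasure_expMeasure hs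
  set L := (expMeasure s).prod ((Measure.infinitePi fun _ : ℕ => expMeasure lam).prod
      (Measure.infinitePi fun _ : ℕ => μ)) with hL
  have hβ : 0 ≤ lam / (lam + s) := by positivity
  have hae : ∀ᵐ y ∂L, ∀ i, 0 < y.2.1 i :=
    (Measure.quasiMeasurePreserving_fst.comp Measure.quasiMeasurePreserving_snd).ae
      (ae_waiting_pos hlam)
  have h1 : (countCell n ∩ {y | y.2.2 ∈ B} : Set (ℝ × ((ℕ → ℝ) × (ℕ → ℝ))))
      = {y | ∑ i ∈ Finset.range n, y.2.1 i ≤ y.1 ∧ y.2.2 ∈ B} \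
        {y | ∑ i ∈ Finset.range (n + 1), y.2.1 i ≤ y.1 ∧ y.2.2 ∈ B} := by
    ext y
    simp only [countCell, mem_inter_iff, mem_ofPred_eq, mem_sdiff, ← not_le]
    tauto
  have h2 : ({y | ∑ i ∈ Finset.range (n + 1), y.2.1 i ≤ y.1 ∧ y.2.2 ∈ B} :
      Set (ℝ × ((ℕ → ℝ) × (ℕ → ℝ)))) ≤ᵐ[L]
      {y | ∑ i ∈ Finset.range n, y.2.1 i ≤ y.1 ∧ y.2.2 ∈ B} := by
    filter_upwards [hae] with y hy hyB
    refine ⟨?_, hyB.2⟩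
    have := hyB.1
    rw [Finset.sum_range_succ] at this
    linarith [hy n]
  rw [h1,
    measure_sdiff' _ (measurableSet_partialSum_le _ hB).nullMeasurableSet (measure_ne_top _ _)]
  have h3 : L ({y | ∑ i ∈ Finset.range n, y.2.1 i ≤ y.1 ∧ y.2.2 ∈ B} ∪
      {y | ∑ i ∈ Finset.range (n + 1), y.2.1 i ≤ y.1 ∧ y.2.2 ∈ B})
      = L {y | ∑ i ∈ Finset.range n, y.2.1 i ≤ y.1 ∧ y.2.2 ∈ B} :=
    measure_congr (union_ae_eq_left_iff_ae_subset.2 h2)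
  rw [h3, hL, measure_partialSum_le hlam hs _ hB, measure_partialSum_le hlam hs _ hB,
    ← ENNReal.sub_mul (fun _ _ => measure_ne_top _ _), ← ENNReal.ofReal_pow hβ,
    ← ENNReal.ofReal_pow hβ, ← ENNReal.ofReal_sub _ (by positivity)]
  congr 2
  ring

end Cells

/-! ### Extrema of the walk at a geometric time. -/

/-- The law of `runFold φ N` for an i.i.d. sequence of law `μ` and an independent geometric
number `N`, `P{N = n} = (1 - β)βⁿ`. -/
noncomputable def foldLaw (β : ℝ) (μ : Measure ℝ) [IsProbabilityMeasure μ] (φ : ℝ → ℝ) :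
    Measure ℝ :=
  Measure.sum fun n : ℕ => ENNReal.ofReal ((1 - β) * β ^ n) •
    (Measure.infinitePi fun _ : ℕ => μ).map (runFold φ n)

section Fold

variable {μ : Measure ℝ} [IsProbabilityMeasure μ]

instance (β : ℝ) (φ : ℝ → ℝ) : SFinite (foldLaw β μ φ) := by
  unfold foldLaw; infer_instance

theorem foldLaw_apply (β : ℝ) {φ : ℝ → ℝ} (hφ : Measurable φ) {A : Set ℝ} (hA : MeasurableSet A) :
    foldLaw β μ φ A = ∑' n : ℕ, ENNReal.ofReal ((1 - β) * β ^ n) *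
      (Measure.infinitePi fun _ : ℕ => μ) (runFold φ n ⁻¹' A) := by
  rw [foldLaw, Measure.sum_apply _ hA]
  refine tsum_congr fun n => ?_
  rw [Measure.smul_apply, smul_eq_mul, Measure.map_apply (measurable_runFold hφ n) hA]

theorem map_runFold_succ {φ : ℝ → ℝ} (hφ : Measurable φ) (n : ℕ) {A : Set ℝ}
    (hA : MeasurableSet A) :
    (Measure.infinitePi fun _ : ℕ => μ) (runFold φ (n + 1) ⁻¹' A)
      = ∫⁻ x, (Measure.infinitePi fun _ : ℕ => μ) (runFold φ n ⁻¹' ((fun w => φ (x + w)) ⁻¹' A))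
        ∂μ := by
  have hm : Measurable fun z : ℝ × (ℕ → ℝ) => φ (z.1 + runFold φ n z.2) :=
    hφ.comp (measurable_fst.add ((measurable_runFold hφ n).comp measurable_snd))
  have h : runFold φ (n + 1) ⁻¹' A = (fun j : ℕ → ℝ => (j 0, fun k => j (k + 1))) ⁻¹'
      ((fun z : ℝ × (ℕ → ℝ) => φ (z.1 + runFold φ n z.2)) ⁻¹' A) := rfl
  rw [h, (measurePreserving_uncons μ).measure_preimage (hm hA).nullMeasurableSet,
    Measure.prod_apply (hm hA)]
  rfl

/-- First-step decomposition of `foldLaw`. -/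
theorem foldLaw_eq {β : ℝ} (h0 : 0 ≤ β) {φ : ℝ → ℝ} (hφ : Measurable φ) :
    foldLaw β μ φ = ENNReal.ofReal (1 - β) • Measure.dirac 0 +
      ENNReal.ofReal β • (μ.prod (foldLaw β μ φ)).map (fun z => φ (z.1 + z.2)) := by
  have hm : Measurable fun z : ℝ × ℝ => φ (z.1 + z.2) :=
    hφ.comp (measurable_fst.add measurable_snd)
  ext A hA
  rw [foldLaw_apply β hφ hA, tsum_eq_zero_add' ENNReal.summable, Measure.add_apply,
    Measure.smul_apply, Measure.smul_apply, Measure.map_apply hm hA, Measure.prod_apply (hm hA)]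
  congr 1
  · simp only [pow_zero, mul_one, smul_eq_mul]
    congr 1
    rw [Measure.dirac_apply' _ hA]
    by_cases h : (0 : ℝ) ∈ A
    · have : runFold φ 0 ⁻¹' A = univ := eq_univ_of_forall fun _ => h
      simp [this, h]
    · have : runFold φ 0 ⁻¹' A = ∅ := eq_empty_of_forall_notMem fun _ => h
      simp [this, h]
  · have hx : ∀ x, MeasurableSet ((fun w => φ (x + w)) ⁻¹' A) := fun x =>
      (hφ.comp (measurable_const.add measurable_id)) hA
    have hpre : ∀ x, Prod.mk x ⁻¹' ((fun z : ℝ × ℝ => φ (z.1 + z.2)) ⁻¹' A)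
        = (fun w => φ (x + w)) ⁻¹' A := fun x => rfl
    simp_rw [hpre, foldLaw_apply β hφ (hx _)]
    rw [lintegral_tsum, smul_eq_mul, ← ENNReal.tsum_mul_left]
    · refine tsum_congr fun n => ?_
      rw [map_runFold_succ hφ n hA, lintegral_const_mul' _ _ ENNReal.ofReal_ne_top, ← mul_assoc,
        ← ENNReal.ofReal_mul h0]
      congr 2
      ring
    · intro n
      refine (Measurable.const_mul ?_ _).aemeasurable
      have hm' : Measurable fun z : ℝ × (ℕ → ℝ) => φ (z.1 + runFold φ n z.2) :=
        hφ.comp (measurable_fst.add ((measurable_runFold hφ n).comp measurable_snd))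
      exact measurable_measure_prodMk_left (hm' hA)

end Fold

/-! ### Identifying the process functionals with those of the walk. -/

section KilledWalk

variable {Ω : Type*} [MeasurableSpace Ω] {P : Measure Ω} {lam s : ℝ} {μ : Measure ℝ}

theorem ae_exists_mem_countCell (hlam : 0 < lam) :
    ∀ᵐ y ∂((expMeasure s).prod ((Measure.infinitePi fun _ : ℕ => expMeasure lam).prod
      (Measure.infinitePi fun _ : ℕ => μ))), (∀ i, 0 < y.2.1 i) ∧ ∃ n, y ∈ countCell n := by
  have := isProbabilityMeasure_expMeasure hlam
  have h1 := (Measure.quasiMeasurePreserving_fst (μ := expMeasure s)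
    (ν := (Measure.infinitePi fun _ : ℕ => expMeasure lam).prod
      (Measure.infinitePi fun _ : ℕ => μ))).ae (ae_expMeasure_pos s)
  have hq := (Measure.quasiMeasurePreserving_fst.comp Measure.quasiMeasurePreserving_snd :
    Measure.QuasiMeasurePreserving _ ((expMeasure s).prod
      ((Measure.infinitePi fun _ : ℕ => expMeasure lam).prod
        (Measure.infinitePi fun _ : ℕ => μ))) (Measure.infinitePi fun _ : ℕ => expMeasure lam))
  have h2 := hq.ae (ae_waiting_pos hlam)
  have h3 := hq.ae (ae_partialSum_unbounded hlam)
  filter_upwards [h1, h2, h3] with y hy1 hy2 hy3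
  refine ⟨hy2, ?_⟩
  classical
  refine ⟨Nat.find (hy3 y.1), ?_, Nat.find_spec (hy3 y.1)⟩
  -- The cell of index `0` has lower end `0`, so there the positivity of `θ` takes the place of
  -- minimality.
  rcases Nat.eq_zero_or_eq_succ_pred (Nat.find (hy3 y.1)) with h | h
  · rw [h]
    simpa using hy1.le
  · have := Nat.find_min (hy3 y.1) (m := (Nat.find (hy3 y.1)).pred) (by omega)
    rw [h]
    exact not_lt.1 this

theorem eq_of_mem_countCell {y : ℝ × ((ℕ → ℝ) × (ℕ → ℝ))} (hy : ∀ i, 0 < y.2.1 i) {m n : ℕ}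
    (hm : y ∈ countCell m) (hn : y ∈ countCell n) : m = n := by
  have hmono : StrictMono fun n => ∑ i ∈ Finset.range n, y.2.1 i :=
    strictMono_nat_of_lt_succ fun n => by
      rw [Finset.sum_range_succ]; linarith [hy n]
  have h1 : m < n + 1 := hmono.lt_iff_lt.1 (hm.1.trans_lt hn.2)
  have h2 : n < m + 1 := hmono.lt_iff_lt.1 (hn.1.trans_lt hm.2)
  omega

variable {ζ J : ℕ → Ω → ℝ} {θ : Ω → ℝ}

theorem ae_arrival_le_of_countCell (hlam : 0 < lam)
    (hX : HasLaw (fun ω => (θ ω, ((fun n => ζ n ω), (fun n => J n ω))))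
      ((expMeasure s).prod ((Measure.infinitePi fun _ : ℕ => expMeasure lam).prod
        (Measure.infinitePi fun _ : ℕ => μ))) P) :
    ∀ᵐ ω ∂P, (∀ i, 0 < ζ i ω) ∧ ∀ n,
      (θ ω, ((fun n => ζ n ω), (fun n => J n ω))) ∈ countCell n →
        0 ≤ θ ω ∧ (∀ k < n, arrival ζ k ω ≤ θ ω) ∧ θ ω < arrival ζ n ω := by
  have hcell := ae_of_ae_map hX.aemeasurable
    (hX.map_eq ▸ ae_exists_mem_countCell (s := s) (μ := μ) hlam)
  filter_upwards [hcell] with ω hω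
  refine ⟨hω.1, fun n hn => ?_⟩
  refine ⟨(Finset.sum_nonneg fun i _ => (hω.1 i).le).trans hn.1, fun k hk => ?_, hn.2⟩
  refine le_trans ?_ hn.1
  exact Finset.sum_le_sum_of_subset_of_nonneg (Finset.range_mono hk) fun i _ _ => (hω.1 i).le

variable [IsProbabilityMeasure μ]

/-- A random variable which is the `n`-th fold on the event that there are `n` jumps up to the
exponential time has law `foldLaw`. -/
theorem hasLaw_foldLaw (hlam : 0 < lam) (hs : 0 < s) {X : Ω → ℝ × ((ℕ → ℝ) × (ℕ → ℝ))}
    (hX : HasLaw X ((expMeasure s).prod ((Measure.infinitePi fun _ : ℕ => expMeasure lam).prod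
      (Measure.infinitePi fun _ : ℕ => μ))) P)
    {φ : ℝ → ℝ} (hφ : Measurable φ) {g : Ω → ℝ}
    (hg : ∀ᵐ ω ∂P, ∀ n, X ω ∈ countCell n → g ω = runFold φ n (X ω).2.2) :
    HasLaw g (foldLaw (lam / (lam + s)) μ φ) P := by
  have hcell := ae_of_ae_map hX.aemeasurable
    (hX.map_eq ▸ ae_exists_mem_countCell (s := s) (μ := μ) hlam)
  have hnull : ∀ n, NullMeasurableSet (X ⁻¹' countCell n) P := fun n =>
    hX.aemeasurable.nullMeasurableSet_preimage (measurableSet_countCell n)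
  have hY : AEMeasurable (fun ω => (X ω).2.2) P :=
    (measurable_snd.comp measurable_snd).comp_aemeasurable hX.aemeasurable
  -- No measurability of `g` is assumed: it is glued from the measurable folds on the countably many
  -- cells, which cover almost everything.
  have hgm : AEMeasurable g P := by
    have h : AEMeasurable g (P.restrict (⋃ n, X ⁻¹' countCell n)) := by
      refine aemeasurable_iUnion_iff.2 fun n => ?_
      refine AEMeasurable.congr (f := fun ω => runFold φ n (X ω).2.2)
        ((measurable_runFold hφ n).comp_aemeasurable hY).restrict ?_
      filter_upwards [ae_restrict_mem₀ (hnull n), ae_restrict_of_ae hg] with ω h1 h2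
      exact (h2 n h1).symm
    rwa [Measure.restrict_eq_self_of_ae_mem] at h
    filter_upwards [hcell] with ω hω
    exact mem_iUnion.2 hω.2
  refine ⟨hgm, ?_⟩
  ext A hA
  rw [Measure.map_apply_of_aemeasurable hgm hA, foldLaw_apply _ hφ hA]
  have hcover : (g ⁻¹' A : Set Ω) =ᵐ[P] (⋃ n, X ⁻¹' (countCell n ∩
      {y | y.2.2 ∈ runFold φ n ⁻¹' A}) : Set Ω) := by
    refine Filter.eventuallyEq_set.2 ?_
    filter_upwards [hcell, hg] with ω h1 h2
    simp only [mem_preimage, mem_iUnion, mem_inter_iff, mem_ofPred_eq]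
    constructor
    · intro h
      obtain ⟨n, hn⟩ := h1.2
      exact ⟨n, hn, h2 n hn ▸ h⟩
    · rintro ⟨n, hn, h⟩
      rw [h2 n hn]
      exact h
  have hmeas : ∀ n, MeasurableSet (countCell n ∩
      {y : ℝ × ((ℕ → ℝ) × (ℕ → ℝ)) | y.2.2 ∈ runFold φ n ⁻¹' A}) := fun n =>
    (measurableSet_countCell n).inter
      ((measurable_snd.comp measurable_snd) (measurable_runFold hφ n hA))
  rw [measure_congr hcover, measure_iUnion₀]
  · refine tsum_congr fun n => ?_
    rw [← Measure.map_apply_of_aemeasurable hX.aemeasurable (hmeas n), hX.map_eq,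
      measure_countCell_inter hlam hs n (measurable_runFold hφ n hA)]
  · intro m n hmn
    refine measure_mono_null (t := {ω | ¬ ((∀ i, 0 < (X ω).2.1 i) ∧ ∃ n, X ω ∈ countCell n)})
      ?_ (ae_iff.1 hcell)
    rintro ω ⟨h1, h2⟩ h3
    exact hmn (eq_of_mem_countCell h3.1 h1.1 h2.1)
  · exact fun n => hX.aemeasurable.nullMeasurableSet_preimage (hmeas n)

theorem hasLaw_runInf (hlam : 0 < lam) (hs : 0 < s)
    (hX : HasLaw (fun ω => (θ ω, ((fun n => ζ n ω), (fun n => J n ω))))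
      ((expMeasure s).prod ((Measure.infinitePi fun _ : ℕ => expMeasure lam).prod
        (Measure.infinitePi fun _ : ℕ => μ))) P) :
    HasLaw (fun ω => runInf ζ J (θ ω) ω) (foldLaw (lam / (lam + s)) μ (min 0)) P := by
  refine hasLaw_foldLaw hlam hs hX (measurable_const.min measurable_id) ?_
  filter_upwards [ae_arrival_le_of_countCell hlam hX] with ω hω n hn
  obtain ⟨h1, h2, h3⟩ := hω.2 n hn
  exact runInf_eq_runFold hω.1 h1 h2 h3

theorem hasLaw_runSup (hlam : 0 < lam) (hs : 0 < s)
    (hX : HasLaw (fun ω => (θ ω, ((fun n => ζ n ω), (fun n => J n ω))))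
      ((expMeasure s).prod ((Measure.infinitePi fun _ : ℕ => expMeasure lam).prod
        (Measure.infinitePi fun _ : ℕ => μ))) P) :
    HasLaw (fun ω => runSup ζ J (θ ω) ω) (foldLaw (lam / (lam + s)) μ (max 0)) P := by
  refine hasLaw_foldLaw hlam hs hX (measurable_const.max measurable_id) ?_
  filter_upwards [ae_arrival_le_of_countCell hlam hX] with ω hω n hn
  obtain ⟨h1, h2, h3⟩ := hω.2 n hn
  exact runSup_eq_runFold hω.1 h1 h2 h3

theorem integral_exp_partialSum (hlam : 0 < lam) (hs : 0 < s) (n : ℕ) :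
    ∫ z, Real.exp (-s * ∑ i ∈ Finset.range n, z i)
      ∂(Measure.infinitePi fun _ : ℕ => expMeasure lam) = (lam / (lam + s)) ^ n := by
  rw [integral_eq_lintegral_of_nonneg_ae (Filter.Eventually.of_forall fun _ => (Real.exp_pos _).le)
    (by fun_prop), lintegral_exp_partialSum hlam hs, ENNReal.toReal_pow,
    ENNReal.toReal_ofReal (by positivity)]

/-- The discounted probability that the walk leaves `(x - T, x)` through the upper boundary. -/
noncomputable def upperExitSum (β : ℝ) (μ : Measure ℝ) [IsProbabilityMeasure μ] (T x : ℝ) : ℝ :=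
  ∑' n : ℕ, β ^ (n + 1) * (Measure.infinitePi fun _ : ℕ => μ).real (upperExit T n x)

/-- On the event of exit at jump index `n`, the exit time is a sum of `n + 1` waiting times, while
the event itself depends on the jumps only. Independence therefore factors each term of the sum. -/
theorem upperExitTransform_eq_upperExitSum [IsProbabilityMeasure P] (hlam : 0 < lam) (hs : 0 < s)
    (hX : HasLaw (fun ω => ((fun n => ζ n ω), (fun n => J n ω)))
      ((Measure.infinitePi fun _ : ℕ => expMeasure lam).prod
        (Measure.infinitePi fun _ : ℕ => μ)) P) {x T : ℝ} (hx : 0 < x) (hxT : x < T) :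
    upperExitTransform P ζ J s x T = upperExitSum (lam / (lam + s)) μ T x := by
  have := isProbabilityMeasure_expMeasure hlam
  have hY : AEMeasurable (fun ω => fun n => J n ω) P :=
    measurable_snd.comp_aemeasurable hX.aemeasurable
  have hZ : AEMeasurable (fun ω => fun n => ζ n ω) P :=
    measurable_fst.comp_aemeasurable hX.aemeasurable
  have hpos : ∀ᵐ ω ∂P, ∀ i, 0 < ζ i ω :=
    ae_of_ae_map hX.aemeasurable (p := fun y => ∀ i, 0 < y.1 i)
      (hX.map_eq ▸ Measure.quasiMeasurePreserving_fst.ae (ae_waiting_pos hlam))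
  have htop : ∀ᵐ ω ∂P, ∀ b, ∃ n, b < arrival ζ n ω :=
    ae_of_ae_map hX.aemeasurable
      (p := fun y => ∀ b : ℝ, ∃ n, b < ∑ i ∈ Finset.range (n + 1), y.1 i)
      (hX.map_eq ▸ Measure.quasiMeasurePreserving_fst.ae (ae_partialSum_unbounded hlam))
  set E : ℕ → Set Ω := fun n => (fun ω => fun k => J k ω) ⁻¹' upperExit T n x with hE
  have hEnull : ∀ n, NullMeasurableSet (E n) P := fun n =>
    hY.nullMeasurableSet_preimage (measurableSet_upperExit_section T n x)
  have hset : exitAbove ζ J x T =ᵐ[P] ⋃ n, E n := by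
    refine Filter.eventuallyEq_set.2 ?_
    filter_upwards [hpos, htop] with ω h1 h2
    rw [mem_exitAbove_iff h1 h2 hx hxT]
    simp [hE]
  have hcongr : ∀ n, (fun ω => Real.exp (-s * exitTime ζ J x T ω)) =ᵐ[P.restrict (E n)]
      fun ω => Real.exp (-s * ∑ i ∈ Finset.range (n + 1), ζ i ω) := by
    intro n
    filter_upwards [ae_restrict_mem₀ (hEnull n), ae_restrict_of_ae hpos] with ω h1 h2
    rw [exitTime_eq_of_mem_upperExit h2 h1]
    rfl
  have hexp : ∀ n, AEStronglyMeasurable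
      (fun ω => Real.exp (-s * ∑ i ∈ Finset.range (n + 1), ζ i ω)) P := by
    intro n
    have hm : Measurable fun z : ℕ → ℝ => Real.exp (-s * ∑ i ∈ Finset.range (n + 1), z i) := by
      fun_prop
    exact (hm.comp_aemeasurable hZ).aestronglyMeasurable
  have hint : IntegrableOn (fun ω => Real.exp (-s * exitTime ζ J x T ω)) (⋃ n, E n) P := by
    refine Integrable.of_bound (C := 1) ?_ (Filter.Eventually.of_forall fun ω => ?_)
    · exact aestronglyMeasurable_iUnion_iff.2 fun n => (hexp n).restrict.congr (hcongr n).symm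
    · rw [Real.norm_of_nonneg (Real.exp_pos _).le, Real.exp_le_one_iff]
      -- This covers paths that never exit as well, since the infimum of the empty set is `0`.
      have : 0 ≤ exitTime ζ J x T ω := Real.sInf_nonneg fun t ht => ht.1.le
      nlinarith
  rw [upperExitTransform, setIntegral_congr_set hset, integral_iUnion_ae hEnull
    (fun m n hmn => ((pairwise_disjoint_upperExit T x hmn).preimage _).aedisjoint) hint,
    upperExitSum]
  refine tsum_congr fun n => ?_
  rw [integral_congr_ae (hcongr n), ← integral_indicator₀ (hEnull n)]
  have h1 : ∀ ω, (E n).indicator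
      (fun ω => Real.exp (-s * ∑ i ∈ Finset.range (n + 1), ζ i ω)) ω
      = (fun y : (ℕ → ℝ) × (ℕ → ℝ) => Real.exp (-s * ∑ i ∈ Finset.range (n + 1), y.1 i) *
        (upperExit T n x).indicator (fun _ => (1 : ℝ)) y.2)
          ((fun n => ζ n ω), (fun n => J n ω)) := by
    intro ω
    by_cases h : ω ∈ E n
    · have h' : (fun k => J k ω) ∈ upperExit T n x := h
      simp [indicator_of_mem h, indicator_of_mem h']
    · have h' : (fun k => J k ω) ∉ upperExit T n x := h
      simp [indicator_of_notMem h, indicator_of_notMem h']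
  have hm : Measurable (fun y : (ℕ → ℝ) × (ℕ → ℝ) =>
      Real.exp (-s * ∑ i ∈ Finset.range (n + 1), y.1 i) *
        (upperExit T n x).indicator (fun _ => (1 : ℝ)) y.2) := by
    refine Measurable.mul (by fun_prop) ?_
    exact (measurable_const.indicator (measurableSet_upperExit_section T n x)).comp measurable_snd
  rw [integral_congr_ae (Filter.Eventually.of_forall h1),
    ← integral_map hX.aemeasurable hm.aestronglyMeasurable, hX.map_eq,
    integral_prod_mul (fun z : ℕ → ℝ => Real.exp (-s * ∑ i ∈ Finset.range (n + 1), z i)),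
    integral_exp_partialSum hlam hs,
    integral_indicator_const _ (measurableSet_upperExit_section T n x), smul_eq_mul, mul_one]

end KilledWalk

/-! ### First-step equations and uniqueness of their bounded solutions. -/

section FirstStep

variable {μ : Measure ℝ} [IsProbabilityMeasure μ] {β : ℝ}

/-- Bounded solutions of the discounted first-step equation on `D` are determined by their values
off `D`. -/
theorem eq_of_first_step (h0 : 0 ≤ β) (h1 : β < 1) {D : Set ℝ} {u v : ℝ → ℝ} {M : ℝ}
    (hu : Measurable u) (hv : Measurable v) (huM : ∀ x, |u x| ≤ M) (hvM : ∀ x, |v x| ≤ M)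
    (hoff : ∀ x ∉ D, u x = v x) (hu1 : ∀ x ∈ D, u x = β * ∫ j, u (x - j) ∂μ)
    (hv1 : ∀ x ∈ D, v x = β * ∫ j, v (x - j) ∂μ) : u = v := by
  have hiu : ∀ x, Integrable (fun j => u (x - j)) μ := fun x =>
    Integrable.of_bound (hu.comp (by fun_prop)).aestronglyMeasurable M
      (Filter.Eventually.of_forall fun j => huM _)
  have hiv : ∀ x, Integrable (fun j => v (x - j)) μ := fun x =>
    Integrable.of_bound (hv.comp (by fun_prop)).aestronglyMeasurable M
      (Filter.Eventually.of_forall fun j => hvM _)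
  have hM : 0 ≤ M := (abs_nonneg _).trans (huM 0)
  -- Each use of the equation gains a factor `β` inside `D`, and outside `D` the difference is zero.
  have key : ∀ n : ℕ, ∀ x, |u x - v x| ≤ β ^ n * (2 * M) := by
    intro n
    induction n with
    | zero =>
      intro x
      have := abs_sub (u x) (v x)
      linarith [huM x, hvM x]
    | succ n ih =>
      intro x
      by_cases hx : x ∈ D
      · rw [hu1 x hx, hv1 x hx, ← mul_sub, ← integral_sub (hiu x) (hiv x), abs_mul,
          abs_of_nonneg h0, pow_succ', mul_assoc]
        refine mul_le_mul_of_nonneg_left ?_ h0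
        have := norm_integral_le_of_norm_le_const (μ := μ) (f := fun j => u (x - j) - v (x - j))
          (Filter.Eventually.of_forall fun j => ih (x - j))
        simpa using this
      · rw [hoff x hx, sub_self, abs_zero]
        positivity
  funext x
  have hlim : Filter.Tendsto (fun n : ℕ => β ^ n * (2 * M)) Filter.atTop (nhds 0) := by
    simpa using (tendsto_pow_atTop_nhds_zero_of_lt_one h0 h1).mul_const (2 * M)
  have := ge_of_tendsto' hlim fun n => key n x
  exact sub_eq_zero.1 (abs_eq_zero.1 (le_antisymm this (abs_nonneg _)))

theorem measurable_measure_upperExit (T : ℝ) (n : ℕ) :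
    Measurable fun x => (Measure.infinitePi fun _ : ℕ => μ) (upperExit T n x) :=
  measurable_measure_prodMk_left (measurableSet_upperExit T n)

theorem upperExitSum_eq_toReal (h0 : 0 ≤ β) (T x : ℝ) :
    upperExitSum β μ T x = (∑' n : ℕ, ENNReal.ofReal (β ^ (n + 1)) *
      (Measure.infinitePi fun _ : ℕ => μ) (upperExit T n x)).toReal := by
  rw [ENNReal.tsum_toReal_eq fun n => ENNReal.mul_ne_top ENNReal.ofReal_ne_top
    (measure_ne_top _ _), upperExitSum]
  refine tsum_congr fun n => ?_
  rw [ENNReal.toReal_mul, ENNReal.toReal_ofReal (by positivity), Measure.real]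

theorem tsum_upperExit_le (h0 : 0 ≤ β) (h1 : β < 1) (T x : ℝ) :
    ∑' n : ℕ, ENNReal.ofReal (β ^ (n + 1)) *
      (Measure.infinitePi fun _ : ℕ => μ) (upperExit T n x) ≤ ENNReal.ofReal (β / (1 - β)) := by
  have hs : HasSum (fun n : ℕ => β ^ (n + 1)) (β / (1 - β)) := by
    simpa [pow_succ', div_eq_mul_inv] using (hasSum_geometric_of_lt_one h0 h1).mul_left β
  rw [← hs.tsum_eq, ENNReal.ofReal_tsum_of_nonneg (fun n => by positivity) hs.summable]
  exact ENNReal.tsum_le_tsum fun n => mul_le_of_le_one_right' prob_le_one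

theorem measurable_upperExitSum (h0 : 0 ≤ β) (T : ℝ) : Measurable (upperExitSum β μ T) := by
  have : upperExitSum β μ T = fun x => (∑' n : ℕ, ENNReal.ofReal (β ^ (n + 1)) *
      (Measure.infinitePi fun _ : ℕ => μ) (upperExit T n x)).toReal :=
    funext fun x => upperExitSum_eq_toReal h0 T x
  rw [this]
  exact (Measurable.tsum fun n =>
    (measurable_measure_upperExit T n).const_mul _).ennreal_toReal

theorem upperExitSum_nonneg (h0 : 0 ≤ β) (T x : ℝ) : 0 ≤ upperExitSum β μ T x := by
  rw [upperExitSum_eq_toReal h0]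
  exact ENNReal.toReal_nonneg

theorem upperExitSum_le (h0 : 0 ≤ β) (h1 : β < 1) (T x : ℝ) :
    upperExitSum β μ T x ≤ β / (1 - β) := by
  rw [upperExitSum_eq_toReal h0]
  exact ENNReal.toReal_le_of_le_ofReal (div_nonneg h0 (by linarith)) (tsum_upperExit_le h0 h1 T x)

theorem upperExitSum_eq_zero {T x : ℝ} (h : ¬ (0 < x ∧ x < T)) : upperExitSum β μ T x = 0 := by
  simp [upperExitSum, upperExit_eq_empty h]

theorem measure_upperExit_zero {T x : ℝ} (h : 0 < x ∧ x < T) :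
    (Measure.infinitePi fun _ : ℕ => μ) (upperExit T 0 x) = μ (Ici x) := by
  have : upperExit T 0 x = (fun j : ℕ → ℝ => j 0) ⁻¹' Ici x := by
    ext j; exact mem_upperExit_zero h j
  rw [this]
  exact (measurePreserving_eval_infinitePi (fun _ : ℕ => μ) 0).measure_preimage
    measurableSet_Ici.nullMeasurableSet

theorem measure_upperExit_succ {T x : ℝ} (h : 0 < x ∧ x < T) (n : ℕ) :
    (Measure.infinitePi fun _ : ℕ => μ) (upperExit T (n + 1) x)
      = ∫⁻ j, (Measure.infinitePi fun _ : ℕ => μ) (upperExit T n (x - j)) ∂μ := by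
  have hm : MeasurableSet {z : ℝ × (ℕ → ℝ) | z.2 ∈ upperExit T n (x - z.1)} :=
    (measurableSet_upperExit T n).preimage
      (f := fun z : ℝ × (ℕ → ℝ) => (x - z.1, z.2)) (by fun_prop)
  have : upperExit T (n + 1) x = (fun j : ℕ → ℝ => (j 0, fun k => j (k + 1))) ⁻¹'
      {z : ℝ × (ℕ → ℝ) | z.2 ∈ upperExit T n (x - z.1)} := by
    ext j; exact mem_upperExit_succ h n j
  rw [this, (measurePreserving_uncons μ).measure_preimage hm.nullMeasurableSet,
    Measure.prod_apply hm]
  rfl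

/-- First-step equation for the upper exit, with boundary value `1` on `(-∞, 0]`. -/
theorem upperExitSum_first_step (h0 : 0 ≤ β) (h1 : β < 1) {T x : ℝ} (h : 0 < x ∧ x < T) :
    upperExitSum β μ T x
      = β * ∫ j, ((Iic 0).indicator 1 (x - j) + upperExitSum β μ T (x - j)) ∂μ := by
  -- The sum over `n` and the integral over the first jump are exchanged in `[0, ∞]`; the bound
  -- `tsum_upperExit_le` permits the return to real numbers.
  set W : ℝ → ℝ≥0∞ := fun x => ∑' n : ℕ, ENNReal.ofReal (β ^ (n + 1)) *
      (Measure.infinitePi fun _ : ℕ => μ) (upperExit T n x) with hW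
  have hWm : Measurable W := Measurable.tsum fun n =>
    (measurable_measure_upperExit T n).const_mul _
  have hWtop : ∀ y, W y < ∞ := fun y =>
    (tsum_upperExit_le h0 h1 T y).trans_lt ENNReal.ofReal_lt_top
  have hstep : W x = ENNReal.ofReal β * (μ (Ici x) + ∫⁻ j, W (x - j) ∂μ) := by
    simp only [hW]
    rw [tsum_eq_zero_add' ENNReal.summable, measure_upperExit_zero h, mul_add, lintegral_tsum]
    · congr 1
      · simp
      · rw [← ENNReal.tsum_mul_left]
        refine tsum_congr fun n => ?_
        rw [measure_upperExit_succ h, lintegral_const_mul' _ _ ENNReal.ofReal_ne_top, ← mul_assoc,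
          ← ENNReal.ofReal_mul h0, pow_succ' β (n + 1)]
    · exact fun n => (((measurable_measure_upperExit T n).comp
        (measurable_const.sub measurable_id)).const_mul _).aemeasurable
  have hreal : ∀ y, upperExitSum β μ T y = (W y).toReal := fun y => upperExitSum_eq_toReal h0 T y
  have hind : ∀ j, (Iic (0 : ℝ)).indicator (1 : ℝ → ℝ) (x - j) = (Ici x).indicator 1 j := by
    intro j
    simp [indicator]
  have hfin : ∫⁻ j, W (x - j) ∂μ ≠ ∞ := by
    refine ((lintegral_mono fun j => tsum_upperExit_le h0 h1 T (x - j)).trans_lt ?_).ne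
    simp
  rw [integral_add]
  · simp_rw [hind, hreal]
    rw [integral_indicator_one measurableSet_Ici, integral_toReal (f := fun j => W (x - j))
      (hWm.comp (measurable_const.sub measurable_id)).aemeasurable
      (Filter.Eventually.of_forall fun j => hWtop _), hstep, ENNReal.toReal_mul,
      ENNReal.toReal_ofReal h0, ENNReal.toReal_add (measure_ne_top _ _) hfin, Measure.real]
  · simp_rw [hind]
    exact (integrable_const (1 : ℝ)).indicator measurableSet_Ici
  · refine Integrable.of_bound ((measurable_upperExitSum h0 T).comp
      (measurable_const.sub measurable_id)).aestronglyMeasurable (β / (1 - β))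
      (Filter.Eventually.of_forall fun j => ?_)
    rw [Real.norm_of_nonneg (upperExitSum_nonneg h0 T _)]
    exact upperExitSum_le h0 h1 T _

/-- First-step equation for the tail of the law of the running maximum. -/
theorem foldLaw_max_first_step (h0 : 0 ≤ β) [IsProbabilityMeasure (foldLaw β μ (max 0))] {x : ℝ}
    (hx : 0 ≤ x) : (foldLaw β μ (max 0)).real (Ioi x)
      = β * ∫ j, (foldLaw β μ (max 0)).real (Ioi (x - j)) ∂μ := by
  have hφ : Measurable (max (0 : ℝ)) := measurable_const.max measurable_id
  have hm : Measurable fun z : ℝ × ℝ => max 0 (z.1 + z.2) :=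
    hφ.comp (measurable_fst.add measurable_snd)
  have hstep : foldLaw β μ (max 0) (Ioi x)
      = ENNReal.ofReal β * ∫⁻ j, foldLaw β μ (max 0) (Ioi (x - j)) ∂μ := by
    conv_lhs => rw [foldLaw_eq h0 hφ]
    rw [Measure.add_apply, Measure.smul_apply, Measure.smul_apply,
      Measure.map_apply hm measurableSet_Ioi, Measure.prod_apply (hm measurableSet_Ioi)]
    have hpre : ∀ j, Prod.mk j ⁻¹' ((fun z : ℝ × ℝ => max 0 (z.1 + z.2)) ⁻¹' Ioi x)
        = Ioi (x - j) := by
      intro j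
      ext w
      simp [not_lt.2 hx, sub_lt_iff_lt_add']
    simp [hpre, not_lt.2 hx]
  have hmono : Monotone fun j => foldLaw β μ (max 0) (Ioi (x - j)) := fun a b hab =>
    measure_mono (Ioi_subset_Ioi (by linarith))
  simp only [Measure.real]
  rw [integral_toReal hmono.measurable.aemeasurable
    (Filter.Eventually.of_forall fun j => measure_lt_top _ _), hstep, ENNReal.toReal_mul,
    ENNReal.toReal_ofReal h0]

theorem foldLaw_max_Ioi_of_neg (h0 : 0 ≤ β) (h1 : β < 1)
    [IsProbabilityMeasure (foldLaw β μ (max 0))] {x : ℝ} (hx : x < 0) :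
    (foldLaw β μ (max 0)).real (Ioi x) = 1 := by
  have hφ : Measurable (max (0 : ℝ)) := measurable_const.max measurable_id
  have hm : Measurable fun z : ℝ × ℝ => max 0 (z.1 + z.2) :=
    hφ.comp (measurable_fst.add measurable_snd)
  have : foldLaw β μ (max 0) (Ioi x) = 1 := by
    rw [foldLaw_eq h0 hφ, Measure.add_apply, Measure.smul_apply, Measure.smul_apply,
      Measure.map_apply hm measurableSet_Ioi]
    have hpre : (fun z : ℝ × ℝ => max 0 (z.1 + z.2)) ⁻¹' Ioi x = univ :=
      eq_univ_of_forall fun z => by simp [hx]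
    rw [hpre]
    simp only [measure_univ, smul_eq_mul, mul_one]
    rw [Measure.dirac_apply' _ measurableSet_Ioi, indicator_of_mem (by simpa using hx),
      Pi.one_apply, mul_one, ← ENNReal.ofReal_add (by linarith) h0]
    simp
  simp [Measure.real, this]

theorem foldLaw_min_Ioi_zero (h0 : 0 ≤ β) : foldLaw β μ (min 0) (Ioi 0) = 0 := by
  have hφ : Measurable (min (0 : ℝ)) := measurable_const.min measurable_id
  have hm : Measurable fun z : ℝ × ℝ => min 0 (z.1 + z.2) :=
    hφ.comp (measurable_fst.add measurable_snd)
  rw [foldLaw_eq h0 hφ, Measure.add_apply, Measure.smul_apply, Measure.smul_apply,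
    Measure.map_apply hm measurableSet_Ioi]
  have hpre : (fun z : ℝ × ℝ => min 0 (z.1 + z.2)) ⁻¹' Ioi 0 = ∅ :=
    eq_empty_of_forall_notMem fun z => by simp
  simp [hpre]

/-- First-step equation for integrals against the law of the running minimum. -/
theorem integral_foldLaw_min (h0 : 0 ≤ β) [IsProbabilityMeasure (foldLaw β μ (min 0))]
    {f : ℝ → ℝ} (hf : Measurable f) {M : ℝ} (hM : ∀ w, |f w| ≤ M) (hf0 : ∀ w, 0 ≤ w → f w = 0) :
    ∫ w, f w ∂(foldLaw β μ (min 0)) = β * ∫ j, ∫ w, f (j + w) ∂(foldLaw β μ (min 0)) ∂μ := by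
  have hφ : Measurable (min (0 : ℝ)) := measurable_const.min measurable_id
  have hm : Measurable fun z : ℝ × ℝ => min 0 (z.1 + z.2) :=
    hφ.comp (measurable_fst.add measurable_snd)
  have hi : ∀ (ν : Measure ℝ) [IsFiniteMeasure ν], Integrable f ν := fun ν _ =>
    Integrable.of_bound hf.aestronglyMeasurable M (Filter.Eventually.of_forall hM)
  -- As `f` vanishes on `[0, ∞)`, it does not see the truncation at `0` in the Lindley recursion;
  -- this also removes the atom term of the first step.
  have hmin : ∀ y, f (min 0 y) = f y := by
    intro y
    rcases le_total 0 y with h | h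
    · rw [min_eq_left h, hf0 0 le_rfl, hf0 y h]
    · rw [min_eq_right h]
  conv_lhs => rw [foldLaw_eq h0 hφ]
  have hfin := Measure.isProbabilityMeasure_map (μ := μ.prod (foldLaw β μ (min 0))) hm.aemeasurable
  rw [integral_add_measure ((hi _).smul_measure ENNReal.ofReal_ne_top)
    ((hi _).smul_measure ENNReal.ofReal_ne_top), integral_smul_measure, integral_smul_measure,
    integral_dirac, hf0 0 le_rfl, smul_zero, zero_add, ENNReal.toReal_ofReal h0, smul_eq_mul,
    integral_map hm.aemeasurable hf.aestronglyMeasurable]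
  simp_rw [hmin]
  rw [integral_prod (fun z : ℝ × ℝ => f (z.1 + z.2))]
  exact Integrable.of_bound (hf.comp (by fun_prop)).aestronglyMeasurable M
    (Filter.Eventually.of_forall fun z => hM _)

end FirstStep

/-! ### Jumps of mixed law and replacement of boundary values. -/

section Jump

variable {p q c : ℝ} {F : Measure ℝ}

theorem isProbabilityMeasure_jumpLaw [IsProbabilityMeasure F] (hp : 0 ≤ p) (hq : 0 ≤ q)
    (hpq : p + q = 1) (hc : 0 < c) :
    IsProbabilityMeasure (jumpLaw p q c F) := by
  have := isProbabilityMeasure_expMeasure hc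
  constructor
  simp [jumpLaw, ← ENNReal.ofReal_add hp hq, hpq]

theorem integrable_jumpLaw {f : ℝ → ℝ} (h1 : Integrable f (expMeasure c)) (h2 : Integrable f F) :
    Integrable f (jumpLaw p q c F) :=
  (h1.smul_measure ENNReal.ofReal_ne_top).add_measure (h2.smul_measure ENNReal.ofReal_ne_top)

theorem integral_jumpLaw (hp : 0 ≤ p) (hq : 0 ≤ q) {f : ℝ → ℝ}
    (h1 : Integrable f (expMeasure c)) (h2 : Integrable f F) :
    ∫ x, f x ∂(jumpLaw p q c F) = p * ∫ x, f x ∂(expMeasure c) + q * ∫ x, f x ∂F := by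
  rw [jumpLaw, integral_add_measure (h1.smul_measure ENNReal.ofReal_ne_top)
    (h2.smul_measure ENNReal.ofReal_ne_top), integral_smul_measure, integral_smul_measure,
    ENNReal.toReal_ofReal hp, ENNReal.toReal_ofReal hq, smul_eq_mul, smul_eq_mul]

theorem ae_nonpos_of_measure_Ioi {ν : Measure ℝ} (hν : ν (Ioi 0) = 0) : ∀ᵐ x ∂ν, x ≤ 0 := by
  rw [ae_iff]
  convert hν using 2
  ext x
  simp

theorem integrable_exp_of_nonpos {ν : Measure ℝ} [IsFiniteMeasure ν] (hν : ν (Ioi 0) = 0) {r : ℝ}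
    (hr : 0 ≤ r) : Integrable (fun x => Real.exp (r * x)) ν := by
  refine Integrable.of_bound (by fun_prop) 1 ?_
  filter_upwards [ae_nonpos_of_measure_Ioi hν] with x hx
  rw [Real.norm_of_nonneg (Real.exp_pos _).le, Real.exp_le_one_iff]
  exact mul_nonpos_of_nonneg_of_nonpos hr hx

/-- Lack of memory of the exponential law. -/
theorem integral_expMeasure_memoryless (hc : 0 < c) {x : ℝ} (hx : 0 ≤ x) (f : ℝ → ℝ) :
    ∫ j, (Ioi x).indicator (fun j => f (j - x)) j ∂(expMeasure c)
      = Real.exp (-c * x) * ∫ η, f η ∂(expMeasure c) := by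
  rw [integral_expMeasure hc, integral_expMeasure hc, ← integral_const_mul]
  have h1 : ∀ j, c * Real.exp (-(c * j)) * (Ioi x).indicator (fun j => f (j - x)) j
      = (Ioi x).indicator (fun j => c * Real.exp (-(c * j)) * f (j - x)) j := by
    intro j
    by_cases hj : j ∈ Ioi x
    · simp only [indicator_of_mem hj]
    · simp only [indicator_of_notMem hj, mul_zero]
  simp_rw [h1]
  rw [setIntegral_indicator measurableSet_Ioi, inter_eq_right.2 (Ioi_subset_Ioi hx),
    ← integral_indicator measurableSet_Ioi, ← integral_indicator measurableSet_Ioi,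
    ← integral_add_right_eq_self _ x]
  congr 1
  ext η
  by_cases hη : 0 < η
  · rw [indicator_of_mem (by simpa using hη), indicator_of_mem (by simpa using hη),
      add_sub_cancel_right]
    have : Real.exp (-(c * (η + x))) = Real.exp (-c * x) * Real.exp (-(c * η)) := by
      rw [← Real.exp_add]; ring_nf
    rw [this]
    ring
  · rw [indicator_of_notMem (by simpa using hη), indicator_of_notMem (by simpa using hη)]

variable {h : ℝ → ℝ} {r C : ℝ}

theorem integrable_comp_neg_expMeasure (hc : 0 < c) (hh : Measurable h) (hrc : r < c)
    (hC : ∀ y, |h y| ≤ C * Real.exp (-r * y)) :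
    Integrable (fun η => h (-η)) (expMeasure c) := by
  refine ((integrable_exp_expMeasure hc hrc).const_mul C).mono'
    (hh.comp measurable_neg).aestronglyMeasurable (Filter.Eventually.of_forall fun η => ?_)
  simpa using hC (-η)

/-- The solutions used may grow like `e^{-ry}` as `y → -∞`; an exponential moment of order `r` of
the jumps absorbs this growth. -/
theorem integrable_comp_sub_of_growth {ν : Measure ℝ}
    (hν : Integrable (fun x => Real.exp (r * x)) ν) (hh : Measurable h)
    (hC : ∀ y, |h y| ≤ C * Real.exp (-r * y)) (x : ℝ) :
    Integrable (fun j => h (x - j)) ν := by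
  refine (hν.const_mul (C * Real.exp (-r * x))).mono'
    (hh.comp (measurable_const.sub measurable_id)).aestronglyMeasurable
    (Filter.Eventually.of_forall fun j => ?_)
  refine (hC (x - j)).trans_eq ?_
  rw [mul_assoc, ← Real.exp_add]
  ring_nf

/-- If `h` solves the first-step equation on `D` and the exponential mean of `h` on the negative
half-line is `1`, then so does `h` with its values beyond the upper boundary replaced by `1`. -/
theorem first_step_piecewise [IsProbabilityMeasure F] (hp : 0 ≤ p) (hq : 0 ≤ q) (hc : 0 < c)
    (hF : F (Ioi 0) = 0)
    (hr : 0 ≤ r) (hrc : r < c) (hh : Measurable h) (hC : ∀ y, |h y| ≤ C * Real.exp (-r * y))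
    {B : Set ℝ} (hlower : IsLowerSet B) (hB1 : Iio 0 ⊆ B) (hB2 : B ⊆ Iic 0)
    [DecidablePred (· ∈ B)]
    (hn : p * (1 - ∫ η, h (-η) ∂(expMeasure c)) = 0) {β x : ℝ} (hx : x ∉ B)
    (hstep : h x = β * ∫ j, h (x - j) ∂(jumpLaw p q c F)) :
    B.piecewise 1 h x = β * ∫ j, B.piecewise 1 h (x - j) ∂(jumpLaw p q c F) := by
  have := isProbabilityMeasure_expMeasure hc
  have hx0 : 0 ≤ x := not_lt.1 fun h' => hx (hB1 h')
  have hie := integrable_comp_sub_of_growth (integrable_exp_expMeasure hc hrc) hh hC x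
  have hiF := integrable_comp_sub_of_growth (integrable_exp_of_nonpos hF hr) hh hC x
  have hineg := integrable_comp_neg_expMeasure hc hh hrc hC
  -- Non-positive jumps increase the distance to the upper boundary, so they cannot reach the lower
  -- set `B` from outside.
  have hFeq : (fun j => B.piecewise 1 h (x - j)) =ᵐ[F] fun j => h (x - j) := by
    filter_upwards [ae_nonpos_of_measure_Ioi hF] with j hj
    exact piecewise_eq_of_notMem _ _ _ fun h' => hx (hlower (by linarith) h')
  have hna : NullSingletonClass (expMeasure c) := by
    rw [expMeasure_eq_withDensity]; infer_instance
  -- The correction depends only on the overshoot `j - x`. The case `j = x` is null, so it is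
  -- irrelevant whether `B` contains `0`: the maximum uses `Iio 0` and the exit uses `Iic 0`.
  have heq : (fun j => B.piecewise 1 h (x - j)) =ᵐ[expMeasure c]
      fun j => h (x - j) + (Ioi x).indicator (fun j => (fun η => 1 - h (-η)) (j - x)) j := by
    have hne : ∀ᵐ j ∂(expMeasure c), j ≠ x := by simp [ae_iff]
    filter_upwards [hne] with j hj
    rcases lt_or_gt_of_ne hj with h' | h'
    · rw [indicator_of_notMem (by simpa using h'.le), add_zero]
      refine piecewise_eq_of_notMem _ _ _ fun h'' => ?_
      have := hB2 h''
      simp only [mem_Iic] at this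
      linarith
    · rw [indicator_of_mem (by simpa using h'),
        piecewise_eq_of_mem _ _ _ (hB1 (by simpa using h'))]
      simp
  have hiind : Integrable
      (fun j => (Ioi x).indicator (fun j => (fun η => 1 - h (-η)) (j - x)) j) (expMeasure c) := by
    refine Integrable.indicator ?_ measurableSet_Ioi
    refine (integrable_const (1 : ℝ)).sub (hie.congr (Filter.Eventually.of_forall fun j => ?_))
    simp
  rw [piecewise_eq_of_notMem _ _ _ hx, hstep, integral_jumpLaw hp hq hie hiF,
    integral_jumpLaw hp hq ((hie.add hiind).congr heq.symm) (hiF.congr hFeq.symm),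
    integral_congr_ae hFeq, integral_congr_ae heq, integral_add hie hiind,
    integral_expMeasure_memoryless hc hx0 (fun η => 1 - h (-η)),
    integral_sub (integrable_const _) hineg]
  simp only [integral_const, probReal_univ, smul_eq_mul, mul_one]
  -- By lack of memory, the correction has mean `e^{-cx}` times the defect in `hn`. The factor `p`
  -- in `hn` lets the case `p = 0` pass with no condition on `h`.
  linear_combination -(β * Real.exp (-c * x)) * hn

theorem measurable_piecewise_one (hh : Measurable h) {B : Set ℝ} (hB : MeasurableSet B)
    [DecidablePred (· ∈ B)] : Measurable (B.piecewise 1 h) :=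
  Measurable.piecewise hB measurable_const hh

theorem abs_piecewise_one_le (hr : 0 ≤ r) (hC : ∀ y, |h y| ≤ C * Real.exp (-r * y)) {B : Set ℝ}
    (hB1 : Iio 0 ⊆ B) [DecidablePred (· ∈ B)] (y : ℝ) : |B.piecewise 1 h y| ≤ max 1 C := by
  by_cases hy : y ∈ B
  · rw [piecewise_eq_of_mem _ _ _ hy]
    simp
  · rw [piecewise_eq_of_notMem _ _ _ hy]
    have hy0 : 0 ≤ y := not_lt.1 fun h' => hy (hB1 h')
    have hC0 : 0 ≤ C := by simpa using (abs_nonneg _).trans (hC 0)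
    refine (hC y).trans ((mul_le_of_le_one_right hC0 ?_).trans (le_max_right _ _))
    rw [Real.exp_le_one_iff]
    nlinarith

/-- The moment generating function of a jump. -/
theorem integral_exp_jumpLaw [IsProbabilityMeasure F] (hp : 0 ≤ p) (hq : 0 ≤ q) (hc : 0 < c)
    (hF : F (Ioi 0) = 0)
    (hr : 0 ≤ r) (hrc : r < c) :
    ∫ x, Real.exp (r * x) ∂(jumpLaw p q c F)
      = p * (c / (c - r)) + q * ∫ x, Real.exp (r * x) ∂F := by
  rw [integral_jumpLaw hp hq (integrable_exp_expMeasure hc hrc) (integrable_exp_of_nonpos hF hr),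
    integral_exp_expMeasure hc hrc]

/-- Exponentials are eigenfunctions of convolution with the jump law, and the root condition makes
the discounted eigenvalue `1`. -/
theorem exp_first_step {μ : Measure ℝ} {β : ℝ}
    (hroot : β * ∫ x, Real.exp (r * x) ∂μ = 1) (x : ℝ) :
    Real.exp (-r * x) = β * ∫ j, Real.exp (-r * (x - j)) ∂μ := by
  have : ∀ j, Real.exp (-r * (x - j)) = Real.exp (-r * x) * Real.exp (r * j) := by
    intro j; rw [← Real.exp_add]; ring_nf
  simp_rw [this]
  rw [integral_const_mul]
  linear_combination -(Real.exp (-r * x)) * hroot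

/-- The law of the maximum up to the geometric time, tested on the positive half-line. -/
theorem foldLaw_max_eq [IsProbabilityMeasure F] (hp : 0 ≤ p) (hq : 0 ≤ q) (hc : 0 < c)
    (hF : F (Ioi 0) = 0)
    [IsProbabilityMeasure (jumpLaw p q c F)] {β : ℝ} (h0 : 0 ≤ β) (h1 : β < 1)
    [IsProbabilityMeasure (foldLaw β (jumpLaw p q c F) (max 0))]
    (hr : 0 ≤ r) (hrc : r < c) (hh : Measurable h) (hC : ∀ y, |h y| ≤ C * Real.exp (-r * y))
    (hn : p * (1 - ∫ η, h (-η) ∂(expMeasure c)) = 0)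
    (hstep : ∀ x, 0 ≤ x → h x = β * ∫ j, h (x - j) ∂(jumpLaw p q c F)) :
    (foldLaw β (jumpLaw p q c F) (max 0)).real (Ioi 0) = h 0 := by
  classical
  have key : (fun x => (foldLaw β (jumpLaw p q c F) (max 0)).real (Ioi x))
      = (Iio (0 : ℝ)).piecewise 1 h := by
    refine eq_of_first_step (μ := jumpLaw p q c F) (D := Ici 0) (M := max 1 C) h0 h1 ?_
      (measurable_piecewise_one hh measurableSet_Iio) ?_
      (abs_piecewise_one_le hr hC subset_rfl) ?_ ?_ ?_
    · exact Antitone.measurable fun a b hab => measureReal_mono (Ioi_subset_Ioi hab)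
    · intro x
      rw [abs_of_nonneg measureReal_nonneg]
      exact measureReal_le_one.trans (le_max_left _ _)
    · intro x hx
      have hx' : x < 0 := by simpa using hx
      rw [foldLaw_max_Ioi_of_neg h0 h1 hx', piecewise_eq_of_mem _ _ _ (by simpa using hx')]
      rfl
    · exact fun x hx => foldLaw_max_first_step h0 hx
    · exact fun x hx => first_step_piecewise hp hq hc hF hr hrc hh hC
        (isLowerSet_Iio 0) subset_rfl Iio_subset_Iic_self hn (by simpa using hx) (hstep x hx)
  have := congrFun key 0
  simpa [piecewise] using this

/-- The upper exit sum as a solution of the first-step equation. -/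
theorem upperExitSum_eq [IsProbabilityMeasure F] (hp : 0 ≤ p) (hq : 0 ≤ q) (hc : 0 < c)
    (hF : F (Ioi 0) = 0)
    [IsProbabilityMeasure (jumpLaw p q c F)] {β : ℝ} (h0 : 0 ≤ β) (h1 : β < 1)
    (hr : 0 ≤ r) (hrc : r < c) (hh : Measurable h) (hC : ∀ y, |h y| ≤ C * Real.exp (-r * y))
    (hn : p * (1 - ∫ η, h (-η) ∂(expMeasure c)) = 0) {T : ℝ}
    (hstep : ∀ x, 0 < x → x < T → h x = β * ∫ j, h (x - j) ∂(jumpLaw p q c F))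
    (hT : ∀ x, T ≤ x → h x = 0) {x : ℝ} (hx : 0 < x) :
    upperExitSum β (jumpLaw p q c F) T x = h x := by
  classical
  have key : (fun x => (Iic (0 : ℝ)).indicator 1 x + upperExitSum β (jumpLaw p q c F) T x)
      = (Iic (0 : ℝ)).piecewise 1 h := by
    refine eq_of_first_step (μ := jumpLaw p q c F) (D := Ioo 0 T)
      (M := max (max 1 C) (1 + β / (1 - β))) h0 h1 ?_
      (measurable_piecewise_one hh measurableSet_Iic) ?_
      (fun y => (abs_piecewise_one_le hr hC Iio_subset_Iic_self y).trans (le_max_left _ _))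
      ?_ ?_ ?_
    · exact (measurable_one.indicator measurableSet_Iic).add (measurable_upperExitSum h0 T)
    · intro x
      have h2 : 0 ≤ (Iic (0 : ℝ)).indicator (1 : ℝ → ℝ) x :=
        indicator_nonneg (fun _ _ => zero_le_one) x
      have h3 : (Iic (0 : ℝ)).indicator (1 : ℝ → ℝ) x ≤ 1 :=
        indicator_le_self' (fun _ _ => zero_le_one) x
      rw [abs_of_nonneg (add_nonneg h2 (upperExitSum_nonneg h0 T x))]
      exact (add_le_add h3 (upperExitSum_le h0 h1 T x)).trans (le_max_right _ _)
    · intro x hx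
      rw [upperExitSum_eq_zero hx, add_zero]
      by_cases hx0 : x ≤ 0
      · rw [indicator_of_mem (by simpa using hx0), piecewise_eq_of_mem _ _ _ (by simpa using hx0)]
      · rw [indicator_of_notMem (by simpa using hx0),
          piecewise_eq_of_notMem _ _ _ (by simpa using hx0),
          hT x (not_lt.1 fun h' => hx ⟨not_le.1 hx0, h'⟩)]
    · intro x hx
      rw [indicator_of_notMem (by simpa using hx.1), zero_add]
      exact upperExitSum_first_step h0 h1 hx
    · exact fun x hx => first_step_piecewise hp hq hc hF hr hrc hh hC
        (isLowerSet_Iic 0) Iio_subset_Iic_self subset_rfl hn (by simpa using hx.1)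
        (hstep x hx.1 hx.2)
  have := congrFun key x
  rwa [indicator_of_notMem (by simpa using hx), zero_add,
    piecewise_eq_of_notMem _ _ _ (by simpa using hx)] at this

end Jump

/-! ### The solution vanishing beyond `T`, built from the law of the minimum. -/

section Tilted

variable {ν : Measure ℝ} {ρ c T : ℝ}

/-- The integral of `e^{ρ(w - x)}` over `w > x - T`. -/
noncomputable def tiltedTail (ν : Measure ℝ) (ρ T x : ℝ) : ℝ :=
  ∫ w, (Ioi (x - T)).indicator (fun w => Real.exp (ρ * (w - x))) w ∂ν

theorem measurable_tilted_indicator (ρ T : ℝ) : Measurable fun z : ℝ × ℝ =>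
    (Ioi (z.1 - T)).indicator (fun w => Real.exp (ρ * (w - z.1))) z.2 := by
  have h : (fun z : ℝ × ℝ => (Ioi (z.1 - T)).indicator (fun w => Real.exp (ρ * (w - z.1))) z.2)
      = {z : ℝ × ℝ | z.1 - T < z.2}.indicator (fun z => Real.exp (ρ * (z.2 - z.1))) := by
    ext z
    simp [indicator]
  rw [h]
  exact Measurable.indicator (by fun_prop) (measurableSet_lt (by fun_prop) (by fun_prop))

theorem measurable_tiltedTail [SFinite ν] (ρ T : ℝ) : Measurable (tiltedTail ν ρ T) :=
  (measurable_tilted_indicator ρ T).stronglyMeasurable.integral_prod_right.measurable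

theorem integrable_tilted [IsFiniteMeasure ν] (hν : ν (Ioi 0) = 0) (hρ : 0 ≤ ρ) (x : ℝ) :
    Integrable (fun w => Real.exp (ρ * (w - x))) ν := by
  refine ((integrable_exp_of_nonpos hν hρ).const_mul (Real.exp (-ρ * x))).congr
    (Filter.Eventually.of_forall fun w => ?_)
  simp only [← Real.exp_add]
  ring_nf

theorem tiltedTail_eq (x : ℝ) (hν : ν (Ioi 0) = 0) :
    tiltedTail ν ρ T x = Real.exp (-ρ * x) * ∫ w in Ioc (x - T) 0, Real.exp (ρ * w) ∂ν := by
  have h : Ioc (x - T) 0 =ᵐ[ν] Ioi (x - T) := by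
    refine Filter.eventuallyEq_set.2 ?_
    filter_upwards [ae_nonpos_of_measure_Ioi hν] with w hw
    simp [hw]
  rw [tiltedTail, integral_indicator measurableSet_Ioi, setIntegral_congr_set h,
    ← integral_const_mul]
  refine integral_congr_ae (Filter.Eventually.of_forall fun w => ?_)
  simp only [← Real.exp_add]
  ring_nf

theorem abs_tiltedTail_le [IsProbabilityMeasure ν] (hν : ν (Ioi 0) = 0) (hρ : 0 ≤ ρ) (x : ℝ) :
    |tiltedTail ν ρ T x| ≤ 1 * Real.exp (-ρ * x) := by
  have h : ∀ᵐ w ∂ν, ‖(Ioi (x - T)).indicator (fun w => Real.exp (ρ * (w - x))) w‖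
      ≤ 1 * Real.exp (-ρ * x) := by
    filter_upwards [ae_nonpos_of_measure_Ioi hν] with w hw
    rw [Real.norm_of_nonneg (indicator_nonneg (fun _ _ => (Real.exp_pos _).le) w), one_mul]
    refine (indicator_le_self' (fun _ _ => (Real.exp_pos _).le) w).trans ?_
    rw [Real.exp_le_exp]
    nlinarith
  simpa [tiltedTail] using norm_integral_le_of_norm_le_const h

theorem tiltedTail_eq_zero (hν : ν (Ioi 0) = 0) {x : ℝ} (hx : T ≤ x) :
    tiltedTail ν ρ T x = 0 := by
  rw [tiltedTail_eq x hν, Ioc_eq_empty (by simpa using hx)]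
  simp

/-- First-step equation for `tiltedTail` of the law of the running minimum. -/
theorem tiltedTail_first_step {μ : Measure ℝ} [IsProbabilityMeasure μ] {β : ℝ} (h0 : 0 ≤ β)
    [IsProbabilityMeasure (foldLaw β μ (min 0))] (hρ : 0 ≤ ρ)
    (hμ : Integrable (fun x => Real.exp (ρ * x)) μ)
    (hroot : β * ∫ x, Real.exp (ρ * x) ∂μ = 1) {x : ℝ} (hx : x < T) :
    tiltedTail (foldLaw β μ (min 0)) ρ T x
      = β * ∫ j, tiltedTail (foldLaw β μ (min 0)) ρ T (x - j) ∂μ := by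
  set ν := foldLaw β μ (min 0) with hνdef
  have hν : ν (Ioi 0) = 0 := foldLaw_min_Ioi_zero h0
  -- `H` is the complementary part: it and `tiltedTail` add up to a multiple of `e^{-ρx}`, which
  -- solves the equation everywhere. It thus suffices to prove the equation for `H`, whose integrand
  -- vanishes on `[0, ∞)` because `x < T`, as the Lindley recursion requires.
  set H : ℝ → ℝ := fun x => ∫ w, (Iic (x - T)).indicator (fun w => Real.exp (ρ * (w - x))) w ∂ν
    with hH
  set φ := ∫ w, Real.exp (ρ * w) ∂ν with hφ
  have hsplit : ∀ x, H x = φ * Real.exp (-ρ * x) - tiltedTail ν ρ T x := by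
    intro x
    have h1 : φ * Real.exp (-ρ * x) = ∫ w, Real.exp (ρ * (w - x)) ∂ν := by
      rw [hφ, mul_comm, ← integral_const_mul]
      refine integral_congr_ae (Filter.Eventually.of_forall fun w => ?_)
      simp only [← Real.exp_add]
      ring_nf
    rw [h1, tiltedTail, ← integral_sub (integrable_tilted hν hρ x)
      ((integrable_tilted hν hρ x).indicator measurableSet_Ioi)]
    refine integral_congr_ae (Filter.Eventually.of_forall fun w => ?_)
    simp only
    by_cases hw : w ≤ x - T
    · rw [indicator_of_mem (by simpa using hw), indicator_of_notMem (by simpa using hw), sub_zero]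
    · rw [indicator_of_notMem (by simpa using hw), indicator_of_mem (by simpa using hw), sub_self]
  have hHstep : H x = β * ∫ j, H (x - j) ∂μ := by
    have := integral_foldLaw_min (μ := μ) h0
      (f := (Iic (x - T)).indicator (fun w => Real.exp (ρ * (w - x))))
      (Measurable.indicator (by fun_prop) measurableSet_Iic) (M := Real.exp (-(ρ * T))) ?_ ?_
    · rw [hH]
      simp only
      rw [this]
      congr 2
      ext j
      congr 1
      ext w
      have hiff : j + w ∈ Iic (x - T) ↔ w ∈ Iic (x - j - T) := by
        simp only [mem_Iic]
        constructor <;> intro h <;> linarith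
      by_cases hw : w ∈ Iic (x - j - T)
      · rw [indicator_of_mem hw, indicator_of_mem (hiff.2 hw)]
        ring_nf
      · rw [indicator_of_notMem hw, indicator_of_notMem fun h => hw (hiff.1 h)]
    · intro w
      rw [abs_of_nonneg (indicator_nonneg (fun _ _ => (Real.exp_pos _).le) w)]
      by_cases hw : w ≤ x - T
      · rw [indicator_of_mem (by simpa using hw), Real.exp_le_exp]
        nlinarith
      · rw [indicator_of_notMem (by simpa using hw)]
        exact (Real.exp_pos _).le
    · intro w hw
      refine indicator_of_notMem ?_ _
      simp only [mem_Iic, not_le]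
      linarith
  have hint1 : Integrable (fun j => φ * Real.exp (-ρ * (x - j))) μ := by
    refine Integrable.const_mul ?_ _
    refine (hμ.const_mul (Real.exp (-ρ * x))).congr (Filter.Eventually.of_forall fun j => ?_)
    simp only [← Real.exp_add]
    ring_nf
  have hint2 : Integrable (fun j => tiltedTail ν ρ T (x - j)) μ :=
    integrable_comp_sub_of_growth hμ (measurable_tiltedTail ρ T) (abs_tiltedTail_le hν hρ) x
  simp_rw [hsplit] at hHstep
  rw [integral_sub hint1 hint2, integral_const_mul] at hHstep
  have := exp_first_step hroot x
  linear_combination φ * this - hHstep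

/-- For `w ≤ -T` the threshold `-T - w` is non-negative and cuts the exponential law; otherwise it
is negative and the whole moment remains. This dichotomy produces the two integrals in the bracket
of the final formula. -/
theorem setIntegral_exp_expMeasure_of_le (hc : 0 < c) (hρc : ρ < c) (w : ℝ) :
    Real.exp (ρ * w) * ∫ η, (Ioi (-T - w)).indicator (fun η => Real.exp (ρ * η)) η ∂(expMeasure c)
      = c / (c - ρ) * if w ≤ -T then Real.exp (-ρ * T) * Real.exp (c * (T + w))
        else Real.exp (ρ * w) := by
  rw [integral_indicator measurableSet_Ioi]
  split_ifs with h
  · rw [setIntegral_Ioi_exp_expMeasure hc hρc (by linarith), mul_left_comm, ← Real.exp_add,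
      ← Real.exp_add]
    ring_nf
  · have : ∀ᵐ η ∂(expMeasure c), η ∈ Ioi (-T - w) := by
      filter_upwards [ae_expMeasure_pos c] with η hη
      simp only [mem_Ioi]
      linarith
    rw [Measure.restrict_eq_self_of_ae_mem this, integral_exp_expMeasure hc hρc, mul_comm]

/-- The exponential mean of `tiltedTail` over the negative half-line. -/
theorem integral_tiltedTail_neg [IsProbabilityMeasure ν] (hν : ν (Ioi 0) = 0) (hc : 0 < c)
    (hρ : 0 ≤ ρ) (hρc : ρ < c) :
    ∫ η, tiltedTail ν ρ T (-η) ∂(expMeasure c) = c / (c - ρ) *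
      ∫ w, (if w ≤ -T then Real.exp (-ρ * T) * Real.exp (c * (T + w))
        else Real.exp (ρ * w)) ∂ν := by
  have := isProbabilityMeasure_expMeasure hc
  have hform : ∀ η w, (Ioi (-η - T)).indicator (fun w => Real.exp (ρ * (w - -η))) w
      = Real.exp (ρ * w) * (Ioi (-T - w)).indicator (fun η => Real.exp (ρ * η)) η := by
    intro η w
    have hiff : w ∈ Ioi (-η - T) ↔ η ∈ Ioi (-T - w) := by
      simp only [mem_Ioi]
      constructor <;> intro h <;> linarith
    by_cases hw : w ∈ Ioi (-η - T)
    · rw [indicator_of_mem hw, indicator_of_mem (hiff.1 hw), ← Real.exp_add]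
      ring_nf
    · rw [indicator_of_notMem hw, indicator_of_notMem fun h => hw (hiff.2 h), mul_zero]
  have hm : Measurable fun z : ℝ × ℝ =>
      (Ioi (-z.1 - T)).indicator (fun w => Real.exp (ρ * (w - -z.1))) z.2 :=
    (measurable_tilted_indicator ρ T).comp (f := fun z : ℝ × ℝ => (-z.1, z.2)) (by fun_prop)
  have hint : Integrable (Function.uncurry fun η w =>
      (Ioi (-η - T)).indicator (fun w => Real.exp (ρ * (w - -η))) w) ((expMeasure c).prod ν) := by
    refine ((integrable_exp_expMeasure hc hρc).mul_prod (integrable_exp_of_nonpos hν hρ)).mono'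
      hm.aestronglyMeasurable (Filter.Eventually.of_forall fun z => ?_)
    simp only [Function.uncurry]
    rw [Real.norm_of_nonneg (indicator_nonneg (fun _ _ => (Real.exp_pos _).le) _)]
    refine (indicator_le_self' (fun _ _ => (Real.exp_pos _).le) _).trans_eq ?_
    rw [← Real.exp_add]
    ring_nf
  simp only [tiltedTail]
  rw [integral_integral_swap hint, ← integral_const_mul]
  refine integral_congr_ae (Filter.Eventually.of_forall fun w => ?_)
  simp only [hform]
  rw [integral_const_mul, setIntegral_exp_expMeasure_of_le hc hρc]

theorem integrable_boundary [IsFiniteMeasure ν] (hν : ν (Ioi 0) = 0) (hc : 0 < c) (hρ : 0 ≤ ρ) :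
    Integrable (fun w => if w ≤ -T then Real.exp (-ρ * T) * Real.exp (c * (T + w))
      else Real.exp (ρ * w)) ν := by
  have h : (fun w => if w ≤ -T then Real.exp (-ρ * T) * Real.exp (c * (T + w))
      else Real.exp (ρ * w)) = (Iic (-T)).piecewise
        (fun w => Real.exp (-ρ * T) * Real.exp (c * (T + w))) (fun w => Real.exp (ρ * w)) := by
    ext w
    simp [piecewise]
  rw [h]
  refine Integrable.piecewise measurableSet_Iic ?_ (integrable_exp_of_nonpos hν hρ).integrableOn
  refine (Integrable.const_mul ?_ _).integrableOn
  refine ((integrable_exp_of_nonpos hν hc.le).const_mul (Real.exp (c * T))).congr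
    (Filter.Eventually.of_forall fun w => ?_)
  simp only [← Real.exp_add]
  ring_nf

theorem integral_boundary_eq [IsFiniteMeasure ν] (hν : ν (Ioi 0) = 0) (hc : 0 < c) (hρ : 0 ≤ ρ) :
    ∫ w, (if w ≤ -T then Real.exp (-ρ * T) * Real.exp (c * (T + w)) else Real.exp (ρ * w)) ∂ν
      = Real.exp (-ρ * T) * (∫ y in Iic (-T), Real.exp (c * (T + y)) ∂ν)
        + ∫ y in Ioc (-T) 0, Real.exp (ρ * y) ∂ν := by
  have hset : Ioc (-T) 0 =ᵐ[ν] ((Iic (-T))ᶜ : Set ℝ) := by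
    refine Filter.eventuallyEq_set.2 ?_
    filter_upwards [ae_nonpos_of_measure_Ioi hν] with w hw
    simp only [mem_Ioc, hw, and_true, mem_compl_iff, mem_Iic, not_le]
  rw [← integral_add_compl measurableSet_Iic (integrable_boundary hν hc hρ) (s := Iic (-T)),
    setIntegral_congr_set hset, ← integral_const_mul]
  congr 1
  · refine setIntegral_congr_fun measurableSet_Iic fun w hw => ?_
    simp only [mem_Iic] at hw
    simp [hw]
  · refine setIntegral_congr_fun measurableSet_Iic.compl fun w hw => ?_
    simp only [mem_compl_iff, mem_Iic] at hw
    simp [hw]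

theorem integral_boundary_pos [IsProbabilityMeasure ν] (hν : ν (Ioi 0) = 0) (hc : 0 < c)
    (hρ : 0 ≤ ρ) : 0 < ∫ w,
      (if w ≤ -T then Real.exp (-ρ * T) * Real.exp (c * (T + w)) else Real.exp (ρ * w)) ∂ν := by
  have hpos : ∀ w : ℝ, 0 < if w ≤ -T then Real.exp (-ρ * T) * Real.exp (c * (T + w))
      else Real.exp (ρ * w) := by
    intro w
    split_ifs <;> positivity
  rw [integral_pos_iff_support_of_nonneg (fun w => (hpos w).le) (integrable_boundary hν hc hρ)]
  have : (Function.support fun w : ℝ => if w ≤ -T then Real.exp (-ρ * T) * Real.exp (c * (T + w))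
      else Real.exp (ρ * w)) = univ := eq_univ_of_forall fun w => (hpos w).ne'
  rw [this]
  simp

end Tilted

/-! ### Lundberg's equation. -/

section Lundberg

variable {lam p q c s : ℝ} {F : Measure ℝ}

theorem cumulant_eq_ofReal (r : ℝ) :
    cumulant lam p q c F (-Complex.I * r)
      = ((lam * p * (c / (c - r) - 1) + lam * q * ((∫ x, Real.exp (r * x) ∂F) - 1) : ℝ) : ℂ) := by
  have h1 : Complex.I * (-Complex.I * r) = r := by
    rw [← mul_assoc, mul_neg, Complex.I_mul_I]; simp
  rw [cumulant, h1]
  have h2 : ∀ x : ℝ, Complex.exp (r * x) = ((Real.exp (r * x) : ℝ) : ℂ) := by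
    intro x; push_cast; rfl
  simp_rw [h2]
  rw [integral_complex_ofReal]
  push_cast
  rfl

variable [IsProbabilityMeasure F]

theorem integral_exp_le_one (hF : F (Ioi 0) = 0) {r : ℝ} (hr : 0 ≤ r) :
    ∫ x, Real.exp (r * x) ∂F ≤ 1 := by
  have h : ∀ᵐ x ∂F, ‖Real.exp (r * x)‖ ≤ 1 := by
    filter_upwards [ae_nonpos_of_measure_Ioi hF] with x hx
    rw [Real.norm_of_nonneg (Real.exp_pos _).le, Real.exp_le_one_iff]
    exact mul_nonpos_of_nonneg_of_nonpos hr hx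
  have := norm_integral_le_of_norm_le_const h
  simp only [probReal_univ, mul_one] at this
  exact (le_abs_self _).trans this

/-- A positive root of the Lundberg equation is less than `c`. -/
theorem lt_of_cumulant_eq (hlam : 0 < lam) (hp : 0 ≤ p) (hq : 0 ≤ q) (hc : 0 < c) (hs : 0 < s)
    (hF : F (Ioi 0) = 0) {r : ℝ} (hr : 0 < r)
    (h : cumulant lam p q c F (-Complex.I * r) = s) : r < c := by
  rw [cumulant_eq_ofReal, Complex.ofReal_inj] at h
  by_contra hrc
  -- This includes `r = c`, where the quotient is `0` by convention.
  have h1 : c / (c - r) ≤ 0 := div_nonpos_of_nonneg_of_nonpos hc.le (by linarith)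
  have h2 := integral_exp_le_one hF hr.le
  have h3 : lam * p * (c / (c - r) - 1) ≤ 0 :=
    mul_nonpos_of_nonneg_of_nonpos (by positivity) (by linarith)
  have h4 : lam * q * ((∫ x, Real.exp (r * x) ∂F) - 1) ≤ 0 :=
    mul_nonpos_of_nonneg_of_nonpos (by positivity) (by linarith)
  linarith

/-- Since `p + q = 1`, the cumulant at `-ir` equals `λ(E e^{rJ} - 1)`, and setting it equal to `s`
means `λ E e^{rJ} = λ + s`. -/
theorem cumulant_eq_iff (hlam : 0 < lam) (hp : 0 ≤ p) (hq : 0 ≤ q) (hpq : p + q = 1) (hc : 0 < c)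
    (hs : 0 < s) (hF : F (Ioi 0) = 0) {r : ℝ} (hr : 0 ≤ r) (hrc : r < c) :
    cumulant lam p q c F (-Complex.I * r) = s ↔
      lam / (lam + s) * ∫ x, Real.exp (r * x) ∂(jumpLaw p q c F) = 1 := by
  rw [cumulant_eq_ofReal, Complex.ofReal_inj, integral_exp_jumpLaw hp hq hc hF hr hrc]
  have hne : lam + s ≠ 0 := by positivity
  rw [div_mul_eq_mul_div, div_eq_one_iff_eq hne]
  have hq' : q = 1 - p := by linarith
  subst hq'
  constructor <;> intro h <;> linarith

/-- Intermediate values on `[0, b]`: the cumulant is `0` at `0` and, because `p > 0`, its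
exponential part blows up at `c`. -/
theorem exists_lundberg_root (hlam : 0 < lam) (hp : 0 < p) (hq : 0 ≤ q) (hc : 0 < c)
    (hs : 0 < s) (hF : F (Ioi 0) = 0) :
    ∃ r, 0 < r ∧ r < c ∧ cumulant lam p q c F (-Complex.I * r) = s := by
  set g : ℝ → ℝ := fun r =>
    lam * p * (c / (c - r) - 1) + lam * q * ((∫ x, Real.exp (r * x) ∂F) - 1) with hg
  obtain ⟨b, hb0, hbc, hb⟩ : ∃ b, 0 < b ∧ b < c ∧ s + lam * q ≤ lam * p * (c / (c - b) - 1) := by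
    -- The witness `b = cK/(1+K)` solves `c/(c-b) - 1 = K`, so the upward part alone makes up for
    -- `s` and for the downward part, which is at least `-λq`.
    set K := (s + lam * q) / (lam * p) with hK
    have hKpos : 0 < K := by positivity
    refine ⟨c * K / (1 + K), by positivity, ?_, ?_⟩
    · rw [div_lt_iff₀ (by positivity)]
      nlinarith
    · have h1 : c / (c - c * K / (1 + K)) - 1 = K := by
        field_simp
        ring
      rw [h1, hK]
      field_simp
      exact le_rfl
  have hcont : ContinuousOn g (Icc 0 b) := by
    refine ContinuousOn.add ?_ ?_
    · refine ContinuousOn.mul continuousOn_const (ContinuousOn.sub ?_ continuousOn_const)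
      refine ContinuousOn.div continuousOn_const (by fun_prop) fun x hx => ?_
      have := hx.2
      exact (by linarith : 0 < c - x).ne'
    · refine ContinuousOn.mul continuousOn_const (ContinuousOn.sub ?_ continuousOn_const)
      refine continuousOn_of_dominated (bound := fun _ => 1) (fun r _ => by fun_prop) ?_
        (integrable_const _) ?_
      · intro r hr
        filter_upwards [ae_nonpos_of_measure_Ioi hF] with x hx
        rw [Real.norm_of_nonneg (Real.exp_pos _).le, Real.exp_le_one_iff]
        exact mul_nonpos_of_nonneg_of_nonpos hr.1 hx
      · exact Filter.Eventually.of_forall fun x => by fun_prop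
  have hg0 : g 0 = 0 := by simp [hg, hc.ne']
  have hgb : s ≤ g b := by
    have h1 : 0 ≤ ∫ x, Real.exp (b * x) ∂F := integral_nonneg fun x => (Real.exp_pos _).le
    have h2 : 0 ≤ lam * q := by positivity
    simp only [hg]
    nlinarith
  obtain ⟨r, hr, hrs⟩ := intermediate_value_Icc hb0.le hcont ⟨hg0.le.trans hs.le, hgb⟩
  have hr0 : r ≠ 0 := fun h => by rw [h, hg0] at hrs; exact hs.ne hrs
  refine ⟨r, lt_of_le_of_ne hr.1 hr0.symm, hr.2.trans_lt hbc, ?_⟩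
  rw [cumulant_eq_ofReal, Complex.ofReal_inj]
  exact hrs

end Lundberg

/-! ### Joint law of the inputs and the value of `q₊`. -/

section Transfer

variable {Ω : Type*} [MeasurableSpace Ω] {P : Measure Ω} [IsProbabilityMeasure P]
  {lam s : ℝ} {μ : Measure ℝ} {ζ J : ℕ → Ω → ℝ} {θ : Ω → ℝ}

theorem hasLaw_waiting_jumps (hlam : 0 < lam) (hζ : ∀ n, HasLaw (ζ n) (expMeasure lam) P)
    (hJ : ∀ n, HasLaw (J n) μ P) (hζ_indep : iIndepFun ζ P) (hJ_indep : iIndepFun J P)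
    (hζJ : IndepFun (fun ω n => ζ n ω) (fun ω n => J n ω) P) :
    HasLaw (fun ω => ((fun n => ζ n ω), (fun n => J n ω)))
      ((Measure.infinitePi fun _ : ℕ => expMeasure lam).prod
        (Measure.infinitePi fun _ : ℕ => μ)) P := by
  have := isProbabilityMeasure_expMeasure hlam
  exact hζJ.hasLaw_prod
    (hζ_indep.hasLaw_infinitePi hζ (aemeasurable_pi_lambda _ fun n => (hζ n).aemeasurable))
    (hJ_indep.hasLaw_infinitePi hJ (aemeasurable_pi_lambda _ fun n => (hJ n).aemeasurable))

theorem qPlus_eq [IsProbabilityMeasure μ] (hlam : 0 < lam) (hs : 0 < s)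
    (hX : HasLaw (fun ω => (θ ω, ((fun n => ζ n ω), (fun n => J n ω))))
      ((expMeasure s).prod ((Measure.infinitePi fun _ : ℕ => expMeasure lam).prod
        (Measure.infinitePi fun _ : ℕ => μ))) P) :
    qPlus P ζ J θ = (foldLaw (lam / (lam + s)) μ (max 0)).real (Ioi 0) := by
  have h0 : 0 ≤ lam / (lam + s) := by positivity
  have h1 : lam / (lam + s) < 1 := (div_lt_one (by positivity)).2 (by linarith)
  have hlaw := hasLaw_runSup hlam hs hX
  have hprob : IsProbabilityMeasure (foldLaw (lam / (lam + s)) μ (max 0)) :=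
    hlaw.isProbabilityMeasure_iff.1 inferInstance
  have hneg : foldLaw (lam / (lam + s)) μ (max 0) (Iio 0) = 0 := by
    have hφ : Measurable (max (0 : ℝ)) := measurable_const.max measurable_id
    have hm : Measurable fun z : ℝ × ℝ => max 0 (z.1 + z.2) :=
      hφ.comp (measurable_fst.add measurable_snd)
    rw [foldLaw_eq h0 hφ, Measure.add_apply, Measure.smul_apply, Measure.smul_apply,
      Measure.map_apply hm measurableSet_Iio]
    have hpre : (fun z : ℝ × ℝ => max 0 (z.1 + z.2)) ⁻¹' Iio 0 = ∅ :=
      eq_empty_of_forall_notMem fun z => by simp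
    simp [hpre]
  rw [qPlus, pPlus, hlaw.measureReal_eq (p := fun y => y = 0) (measurableSet_singleton 0)]
  have hset : ({y | y = 0} : Set ℝ) =ᵐ[foldLaw (lam / (lam + s)) μ (max 0)]
      ((Ioi 0)ᶜ : Set ℝ) := by
    have hae : ∀ᵐ y ∂(foldLaw (lam / (lam + s)) μ (max 0)), ¬ y < 0 := by
      rw [ae_iff]
      simp only [not_not]
      exact hneg
    refine Filter.eventuallyEq_set.2 ?_
    filter_upwards [hae] with y hy
    simp only [mem_compl_iff, mem_Ioi, not_lt]
    exact ⟨fun h => h.le, fun h => le_antisymm h (not_lt.1 hy)⟩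
  rw [measureReal_congr hset, probReal_compl_eq_one_sub measurableSet_Ioi, sub_sub_cancel]

end Transfer

end AlmostSemicontinuous

/-! ### Assembling the root and the exit formula. -/

open AlmostSemicontinuous in
theorem theorem1 {Ω : Type*} [MeasurableSpace Ω] (P : Measure Ω) [IsProbabilityMeasure P]
    -- parameters of the process
    (lam p q c : ℝ) (hlam : 0 < lam) (hp : 0 ≤ p) (hq : 0 ≤ q) (hpq : p + q = 1) (hc : 0 < c)
    (F : Measure ℝ) [IsProbabilityMeasure F] (hF : F (Ioi 0) = 0)
    -- waiting times and jumps of the compound Poisson process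
    (ζ J : ℕ → Ω → ℝ)
    (hζ : ∀ n, HasLaw (ζ n) (expMeasure lam) P)
    (hJ : ∀ n, HasLaw (J n) (AlmostSemicontinuous.jumpLaw p q c F) P)
    (hζ_indep : iIndepFun ζ P) (hJ_indep : iIndepFun J P)
    (hζJ : IndepFun (fun ω n => ζ n ω) (fun ω n => J n ω) P)
    -- an exponential time, independent of the process
    (s : ℝ) (hs : 0 < s) (θ : Ω → ℝ) (hθ : HasLaw θ (expMeasure s) P)
    (hθ_indep : IndepFun θ (fun ω => ((fun n => ζ n ω), (fun n => J n ω))) P)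
    (x T : ℝ) (hx : 0 < x) (hxT : x < T) :
    let Q := AlmostSemicontinuous.upperExitTransform P ζ J s x T
    let qp := AlmostSemicontinuous.qPlus P ζ J θ
    let ρ := AlmostSemicontinuous.rhoPlus P ζ J θ c
    let Pm := AlmostSemicontinuous.infLaw P ζ J θ
    -- `ρ₊(s)` is the positive root of the Lundberg equation `ψ(-ir) = s`
    (0 < p → 0 < ρ ∧ ∀ r : ℝ, 0 < r →
      (AlmostSemicontinuous.cumulant lam p q c F (-Complex.I * r) = s ↔ r = ρ)) ∧
    Q = qp * Real.exp (-ρ * x) * (∫ y in Ioc (x - T) 0, Real.exp (ρ * y) ∂Pm) *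
      (Real.exp (-ρ * T) * (∫ y in Iic (-T), Real.exp (c * (T + y)) ∂Pm)
        + ∫ y in Ioc (-T) 0, Real.exp (ρ * y) ∂Pm)⁻¹ := by
  intro Q qp ρ Pm
  have hprobJ : IsProbabilityMeasure (jumpLaw p q c F) := isProbabilityMeasure_jumpLaw hp hq hpq hc
  have hprobs := isProbabilityMeasure_expMeasure hs
  have hprobl := isProbabilityMeasure_expMeasure hlam
  have h0 : 0 ≤ lam / (lam + s) := by positivity
  have h1 : lam / (lam + s) < 1 := (div_lt_one (by positivity)).2 (by linarith)
  have hZJ := hasLaw_waiting_jumps hlam hζ hJ hζ_indep hJ_indep hζJ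
  have hX := hθ_indep.hasLaw_prod hθ hZJ
  have hprobsup : IsProbabilityMeasure (foldLaw (lam / (lam + s)) (jumpLaw p q c F) (max 0)) :=
    (hasLaw_runSup hlam hs hX).isProbabilityMeasure_iff.1 inferInstance
  have hprobinf : IsProbabilityMeasure (foldLaw (lam / (lam + s)) (jumpLaw p q c F) (min 0)) :=
    (hasLaw_runInf hlam hs hX).isProbabilityMeasure_iff.1 inferInstance
  have hPm : Pm = foldLaw (lam / (lam + s)) (jumpLaw p q c F) (min 0) :=
    (hasLaw_runInf hlam hs hX).map_eq
  have hQ : Q = upperExitSum (lam / (lam + s)) (jumpLaw p q c F) T x :=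
    upperExitTransform_eq_upperExitSum hlam hs hZJ hx hxT
  have hqp : qp = (foldLaw (lam / (lam + s)) (jumpLaw p q c F) (max 0)).real (Ioi 0) :=
    qPlus_eq hlam hs hX
  have hρ : ρ = c * (1 - qp) := by simp [ρ, qp, rhoPlus, qPlus]
  -- Every positive root is forced to equal `ρ`, so no convexity of the cumulant is needed for
  -- uniqueness.
  have hroot : ∀ r : ℝ, 0 < r → cumulant lam p q c F (-Complex.I * r) = s → r < c ∧ r = ρ := by
    intro r hr h
    have hrc := lt_of_cumulant_eq hlam hp hq hc hs hF hr h
    refine ⟨hrc, ?_⟩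
    rw [cumulant_eq_iff hlam hp hq hpq hc hs hF hr.le hrc] at h
    have hκ : 0 ≤ 1 - r / c := sub_nonneg.2 ((div_le_one hc).2 hrc.le)
    have hcr : c - r ≠ 0 := by linarith
    -- The factor `1 - r/c` is the inverse of the exponential moment `c/(c-r)`, which normalises the
    -- mean beyond the boundary to `1`.
    have hval := foldLaw_max_eq (p := p) (q := q) (c := c) (F := F) (r := r) (C := 1 - r / c)
      (h := fun y => (1 - r / c) * Real.exp (-r * y)) hp hq hc hF h0 h1 hr.le hrc
      (by fun_prop) (fun y => by rw [abs_of_nonneg (by positivity)]) ?_ ?_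
    · rw [hρ, hqp, hval]
      simp only [mul_zero, Real.exp_zero, mul_one]
      field_simp
      ring
    · have : ∀ η : ℝ, (1 - r / c) * Real.exp (-r * -η) = (1 - r / c) * Real.exp (r * η) := by
        intro η; ring_nf
      simp_rw [this]
      rw [integral_const_mul, integral_exp_expMeasure hc hrc]
      have : (1 - r / c) * (c / (c - r)) = 1 := by field_simp
      rw [this, sub_self, mul_zero]
    · intro y _
      rw [integral_const_mul, exp_first_step h y]
      ring
  -- Without upward jumps the zero function is the solution, and both sides of the formula are zero.
  rcases hp.eq_or_lt with hp0 | hp0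
  · refine ⟨fun h => absurd h (hp0 ▸ lt_irrefl 0), ?_⟩
    have hq0 : qp = 0 := by
      rw [hqp]
      exact foldLaw_max_eq (h := fun _ => 0) (r := 0) (C := 0) hp hq hc hF h0 h1 le_rfl hc
        measurable_const (by simp) (by simp [← hp0]) (by simp)
    rw [hq0, hQ, upperExitSum_eq (h := fun _ => 0) (r := 0) (C := 0) hp hq hc hF h0 h1 le_rfl hc
        measurable_const (by simp) (by simp [← hp0]) (by simp) (by simp) hx]
    ring
  · obtain ⟨r₀, hr₀, -, hr₀s⟩ := exists_lundberg_root hlam hp0 hq hc hs hF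
    obtain ⟨hρc, hr₀ρ⟩ := hroot r₀ hr₀ hr₀s
    rw [hr₀ρ] at hr₀ hρc hr₀s
    refine ⟨fun _ => ⟨hr₀, fun r hr => ⟨fun h => (hroot r hr h).2, fun h => h ▸ hr₀s⟩⟩, ?_⟩
    have hν := foldLaw_min_Ioi_zero (μ := jumpLaw p q c F) h0
    have hβ := (cumulant_eq_iff hlam hp hq hpq hc hs hF hr₀.le hρc).1 hr₀s
    rw [hQ, hPm, ← integral_boundary_eq hν hc hr₀.le]
    set ν := foldLaw (lam / (lam + s)) (jumpLaw p q c F) (min 0) with hνdef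
    have hCpos := integral_boundary_pos (T := T) hν hc hr₀.le
    have hCeq := integral_tiltedTail_neg (T := T) hν hc hr₀.le hρc
    set C := ∫ w, (if w ≤ -T then Real.exp (-ρ * T) * Real.exp (c * (T + w))
      else Real.exp (ρ * w)) ∂ν with hC
    have hcρ : c - ρ ≠ 0 := by linarith
    have hqpc : qp = (c - ρ) / c := by rw [hρ]; field_simp; ring
    -- The exponential mean of `tiltedTail` is `C · c/(c-ρ) = C/qp`, whence the constant `qp / C`.
    rw [upperExitSum_eq (h := fun y => qp / C * tiltedTail ν ρ T y) (r := ρ) (C := qp / C * 1)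
      hp hq hc hF h0 h1 hr₀.le hρc ((measurable_tiltedTail ρ T).const_mul _) ?_ ?_ ?_ ?_ hx,
      tiltedTail_eq x hν]
    · ring
    · intro y
      have hpos : 0 ≤ qp / C := div_nonneg (hqp ▸ measureReal_nonneg) hCpos.le
      rw [abs_mul, abs_of_nonneg hpos, mul_assoc]
      exact mul_le_mul_of_nonneg_left (abs_tiltedTail_le hν hr₀.le y) hpos
    · rw [integral_const_mul, hCeq, hqpc]
      have : (c - ρ) / c / C * (c / (c - ρ) * C) = 1 := by
        field_simp
      rw [this, sub_self, mul_zero]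
    · intro y _ hyT
      rw [integral_const_mul]
      have hint : Integrable (fun x => Real.exp (ρ * x)) (jumpLaw p q c F) :=
        integrable_jumpLaw (integrable_exp_expMeasure hc hρc) (integrable_exp_of_nonpos hF hr₀.le)
      rw [hνdef, tiltedTail_first_step h0 hr₀.le hint hβ hyT]
      ring
    · intro y hy
      rw [tiltedTail_eq_zero hν hy, mul_zero]
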